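/- **Setting.** Let $(\Omega,\mathcal F,\mathbb P)$ be a probability space, $\Sigma$ a finite alphabet, $\Sigma^+$ the set of nonempty words, $\epsilon$ the empty word, and $\Sigma^*=\Sigma^+\cup\{\epsilon\}$. Random variables that are almost surely equal are identified. Let $\{u_\sigma(t)\}_{t\in\mathbb Z}$, $\sigma\in\Sigma$, be real input processes. For $w=\sigma_1\cdots\sigma_k\in\Sigma^+$ put $u_w(t)=u_{\sigma_1}(t-k+1)u_{\sigma_2}(t-k+2)\cdots u_{\sigma_k}(t)$. Assume that $\sum_\sigma\alpha_\sigma u_\sigma(t)=1$ for all $t$ with some constants $\alpha_\sigma\in\mathbb R$, and that every $u_w(t)$, $w\in\Sigma^+$, has finite first and second moments. Fix numbers $p_\sigma>0$ and put $p_w=p_{\sigma_1}\cdots p_{\sigma_k}$. Fix a set $L\subseteq\Sigma^+$ of admissible words: $\Sigma\subseteq L$; $u_w(t)=0$ a.s. for all $t$ whenever $w\in\Sigma^+\setminus L$; and there is $E\subseteq\Sigma\times\Sigma$ such that a word $\sigma_1\cdots\sigma_k$ with $k>1$ lies in $L$ iff $(\sigma_i,\sigma_{i+1})\in E$ for all $i<k$.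 For an $\mathbb R^k$-valued process $r$ and $w\in\Sigma^+$ let $z^r_w(t)=r(t-|w|)\,u_w(t-1)/\sqrt{p_w}$, $T^r_{w,v}=E[z^r_w(t)z^r_v(t)^T]$ and $\Lambda^r_w=E[r(t)z^r_w(t)^T]$. The process $r$ is *RC* if * all $r(t)$ and $z^r_w(t)$ are square integrable with mean zero, and $T^r_{w,v}$, $\Lambda^r_w$ do not depend on $t$; * for all $w,v\in\Sigma^+$ and $\sigma\ne\sigma'$ in $\Sigma$: $T^r_{\sigma,\sigma'}=0$, $T^r_{w\sigma,v\sigma'}=0$ and $T^r_{w\sigma,\sigma'}=0$; * for all $w,v\in\Sigma^+$, $\sigma\in\Sigma$: $T^r_{w\sigma,v\sigma}=T^r_{w,v}$ if $w\sigma\in L$ or $v\sigma\in L$, and $T^r_{w\sigma,\sigma}=(\Lambda^r_w)^T$ if $w\sigma\in L$; * $T^r_{w,v}=0$ if $w\notin L$ or $v\notin L$; and $T^r_{v,w}=0$ if for some $\sigma\in\Sigma$ exactly one of $w\sigma,v\sigma$ lies in $L$. A *generalized bilinear system (GBS)* $\mathrm B$ of dimension $n$ with output dimension $p$ is $$x(t+1)=\sum_{\sigma}(A_\sigma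 x(t)+K_\sigma v(t))u_\sigma(t),\qquad y(t)=Cx(t)+Dv(t)\qquad(t\in\mathbb Z),$$ with real matrices $A_\sigma\in\mathbb R^{n\times n}$, $K_\sigma\in\mathbb R^{n\times m}$, $C\in\mathbb R^{p\times n}$, $D\in\mathbb R^{p\times m}$ (the noise dimension $m$ is arbitrary), a state process $x$ and a noise process $v$; it is then a *realization* of $y$. Call $\mathrm B$ *regular* if 1. $v$ is RC; 2. $E[z^v_w(t)z^v_{w'}(t)^T]=0$ for all $w\neq w'$ in $\Sigma^+$; 3. the coordinates of $x(t)$ lie in the closed linear span in $L^2$ of the coordinates of $z^v_w(t)$, $w\in\Sigma^+$; 4. all eigenvalues of $\sum_\sigma p_\sigma A_\sigma^T\otimes A_\sigma^T$ have modulus $<1$; 5. $A_{\sigma_2}A_{\sigma_1}=0$ and $A_{\sigma_2}K_{\sigma_1}T^v_{\sigma_1,\sigma_1}=0$ whenever $\sigma_1\sigma_2\notin L$. A regular realization of $y$ is *minimal* if its dimension is smallest among all regular GBS realizations of $y$. A *representation* of dimension $n$ of a family $\Psi=\{S_j:\Sigma^*\to\mathbb R^p\}_{j\in J}$ is a tuple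 $R=(\mathbb R^n,\{F_\sigma\}_{\sigma\in\Sigma},\{G_j\}_{j\in J},H)$ with $S_j(\sigma_1\cdots\sigma_k)=HF_{\sigma_k}\cdots F_{\sigma_1}G_j$ for all words (including $\epsilon$) and all $j$. It is *minimal* if no representation of $\Psi$ has smaller dimension. Two representations $R,\widetilde R$ are *isomorphic* if they have the same dimension and there is a nonsingular matrix $T$ with $T\widetilde F_\sigma=F_\sigma T$, $T\widetilde G_j=G_j$, $\widetilde H=HT$ for all $\sigma,j$. Let $\Psi_y=\{S_{(j,\sigma)}\mid 1\le j\le p,\ \sigma\in\Sigma\}$, where $S_{(j,\sigma)}(w)$ is the $j$-th column of $\Lambda^y_{\sigma w}$ (for $y$ with a regular GBS realization, this may be evaluated at any $t$). For a regular GBS $\mathrm B$ let $Q_\sigma=E[v(t)v(t)^Tu_\sigma(t)^2]$ (independent of $t$), and consider the equations $$P_\sigma=p_\sigma\sum_{\tau\in\Sigma,\ \tau\sigma\in L}\bigl(A_\tau P_\tau A_\tau^T+K_\tau Q_\tau K_\tau^T\bigr),\qquad\sigma\in\Sigma .\tag{1}$$ Given a solution $\{P_\sigma\}$, put $B_\sigma=\frac1{\sqrt{p_\sigma}}(A_\sigma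 P_\sigma C^T+K_\sigma Q_\sigma D^T)$; the *representation associated with* $\mathrm B$ is $R_{\mathrm B}=(\mathbb R^n,\{\sqrt{p_\sigma}A_\sigma\}_{\sigma},\{B_{\sigma,j}\}_{(j,\sigma)},C)$, where $B_{\sigma,j}$ is the $j$-th column of $B_\sigma$. **Theorem (Minimality of GBSs).** Let $\mathrm B$ be a regular GBS which is a realization of $y$. Then (1) has a unique solution, so that $R_{\mathrm B}$ is well defined, and $\mathrm B$ is a minimal realization of $y$ if and only if $R_{\mathrm B}$ is a minimal representation of $\Psi_y$. If $\mathrm B_1$ and $\mathrm B_2$ are both minimal (regular) realizations of $y$, then $R_{\mathrm B_1}$ and $R_{\mathrm B_2}$ are isomorphic. -/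

import Mathlib

open MeasureTheory
open scoped Matrix Kronecker

namespace GBSRealization

/-! ## Formal power series and their representations

Words over the alphabet `S` are lists `[σ₁, …, σₖ]`, the empty word is `[]`. -/

/-- `A_w = A_{σₖ} ⋯ A_{σ₁}` for `w = σ₁ ⋯ σₖ`, and `A_ε = 1`. -/
def wordProd {S : Type*} {n : ℕ} (A : S → Matrix (Fin n) (Fin n) ℝ) :
    List S → Matrix (Fin n) (Fin n) ℝ
  | [] => 1
  | σ :: w => wordProd A w * A σ

/-- A family, indexed by `J`, of formal power series over `S` with coefficients in `ℝᵖ`. -/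
abbrev SeriesFamily (S J : Type*) (p : ℕ) := J → List S → (Fin p → ℝ)

/-- A tuple `R = (ℝⁿ, {A_σ}, {B_j}, C)`; `dim` is the dimension `n`. -/
structure Representation (S J : Type*) (p : ℕ) where
  dim : ℕ
  A : S → Matrix (Fin dim) (Fin dim) ℝ
  B : J → (Fin dim → ℝ)
  C : Matrix (Fin p) (Fin dim) ℝ

namespace Representation

variable {S J : Type*} {p : ℕ}

/-- `R` is a representation of `Ψ`: `Ψ_j(w) = C A_w B_j` for all `j` and `w`. -/
def Represents (R : Representation S J p) (Ψ : SeriesFamily S J p) : Prop :=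
  ∀ (j : J) (w : List S), Ψ j w = R.C *ᵥ (wordProd R.A w *ᵥ R.B j)

/-- `R` is a minimal representation of `Ψ`. -/
def IsMinimalOf (R : Representation S J p) (Ψ : SeriesFamily S J p) : Prop :=
  R.Represents Ψ ∧ ∀ R' : Representation S J p, R'.Represents Ψ → R.dim ≤ R'.dim

/-- `R` and `R'` have the same dimension and there is a nonsingular matrix `T` (with inverse `T'`)
such that `T A'_σ = A_σ T`, `T B'_j = B_j` and `C' = C T`. -/
def Isomorphic (R R' : Representation S J p) : Prop :=
  R.dim = R'.dim ∧
  ∃ (T : Matrix (Fin R.dim) (Fin R'.dim) ℝ) (T' : Matrix (Fin R'.dim) (Fin R.dim) ℝ),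
    T * T' = 1 ∧ T' * T = 1 ∧
    (∀ σ, T * R'.A σ = R.A σ * T) ∧ (∀ j, T *ᵥ R'.B j = R.B j) ∧ R'.C = R.C * T

end Representation

/-! ## Second order calculus of random vectors -/

section Random

variable {Ω : Type*} [MeasurableSpace Ω]

/-- The matrix `E[a bᵀ]`. -/
noncomputable def crossCov (μ : Measure Ω) {k l : ℕ} (a : Ω → Fin k → ℝ) (b : Ω → Fin l → ℝ) :
    Matrix (Fin k) (Fin l) ℝ :=
  Matrix.of fun i j => ∫ ω, a ω i * b ω j ∂μ

/-- The Hilbert space generated by the set `Z` of scalar random variables: the closed linear span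
in `L²(μ)` of (the classes of) its elements. -/
noncomputable def generatedHilbertSpace (μ : Measure Ω) (Z : Set (Ω → ℝ)) :
    Submodule ℝ (Lp ℝ 2 μ) :=
  (Submodule.span ℝ {f : Lp ℝ 2 μ | ∃ g ∈ Z, (f : Ω → ℝ) =ᵐ[μ] g}).topologicalClosure

/-- The random vector `x` belongs to the subspace `M` of `L²(μ)`: the class of each of its
coordinates is an element of `M`. -/
def BelongsTo (μ : Measure Ω) {k : ℕ} (x : Ω → Fin k → ℝ) (M : Submodule ℝ (Lp ℝ 2 μ)) : Prop :=
  ∀ i, ∃ f ∈ M, (f : Ω → ℝ) =ᵐ[μ] fun ω => x ω i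

/-! ## Input process, admissible words, recursive covariance property -/

variable {S : Type*}

/-- `u_w(t) = u_{σ₁}(t-k+1) u_{σ₂}(t-k+2) ⋯ u_{σₖ}(t)` for `w = σ₁ ⋯ σₖ`. -/
def inputProd (u : S → ℤ → Ω → ℝ) (w : List S) (t : ℤ) (ω : Ω) : ℝ :=
  ∏ i : Fin w.length, u (w.get i) (t - w.length + 1 + (i : ℕ)) ω

/-- `p_w = p_{σ₁} ⋯ p_{σₖ}`. -/
def wordWeight (pr : S → ℝ) (w : List S) : ℝ := (w.map pr).prod

/-- `z^r_w(t) = r(t-|w|) u_w(t-1) / √p_w`. -/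
noncomputable def zproc (u : S → ℤ → Ω → ℝ) (pr : S → ℝ) {k : ℕ} (r : ℤ → Ω → Fin k → ℝ)
    (w : List S) (t : ℤ) (ω : Ω) : Fin k → ℝ :=
  (inputProd u w (t - 1) ω / √(wordWeight pr w)) • r (t - w.length) ω

/-- `T^r_{w,v} = E[z^r_w(t) z^r_v(t)ᵀ]`. -/
noncomputable def Tcov (μ : Measure Ω) (u : S → ℤ → Ω → ℝ) (pr : S → ℝ) {k : ℕ}
    (r : ℤ → Ω → Fin k → ℝ) (w v : List S) (t : ℤ) : Matrix (Fin k) (Fin k) ℝ :=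
  crossCov μ (zproc u pr r w t) (zproc u pr r v t)

/-- `Λ^r_w = E[r(t) z^r_w(t)ᵀ]`. -/
noncomputable def Lcov (μ : Measure Ω) (u : S → ℤ → Ω → ℝ) (pr : S → ℝ) {k : ℕ}
    (r : ℤ → Ω → Fin k → ℝ) (w : List S) (t : ℤ) : Matrix (Fin k) (Fin k) ℝ :=
  crossCov μ (r t) (zproc u pr r w t)

/-- Standing assumption on the input: a fixed linear combination of the inputs is `1`, and all
`u_w(t)` (`w` nonempty) have finite first and second moments. -/
structure InputAssumption [Fintype S] (μ : Measure Ω) (u : S → ℤ → Ω → ℝ) : Prop where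
  affine : ∃ α : S → ℝ, ∀ t, ∀ᵐ ω ∂μ, ∑ σ, α σ * u σ t ω = 1
  moments : ∀ w : List S, w ≠ [] → ∀ t, MemLp (inputProd u w t) 2 μ

/-- `L` is a set of admissible (nonempty) words. -/
structure IsAdmissible (μ : Measure Ω) (u : S → ℤ → Ω → ℝ) (L : Set (List S)) : Prop where
  nonempty : ∀ w ∈ L, w ≠ []
  letters : ∀ σ, [σ] ∈ L
  vanish : ∀ w : List S, w ≠ [] → w ∉ L → ∀ t, inputProd u w t =ᵐ[μ] 0
  transitions : ∃ E : S → S → Prop, ∀ w : List S, 1 < w.length → (w ∈ L ↔ w.IsChain E)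

/-- The recursive covariance property. -/
structure IsRC (μ : Measure Ω) (u : S → ℤ → Ω → ℝ) (pr : S → ℝ) (L : Set (List S)) {k : ℕ}
    (r : ℤ → Ω → Fin k → ℝ) : Prop where
  memLp : ∀ t i, MemLp (fun ω => r t ω i) 2 μ
  memLp_z : ∀ w : List S, w ≠ [] → ∀ t i, MemLp (fun ω => zproc u pr r w t ω i) 2 μ
  mean : ∀ t i, ∫ ω, r t ω i ∂μ = 0
  mean_z : ∀ w : List S, w ≠ [] → ∀ t i, ∫ ω, zproc u pr r w t ω i ∂μ = 0
  stat_L : ∀ w : List S, w ≠ [] → ∀ t k, Lcov μ u pr r w (t + k) = Lcov μ u pr r w t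
  stat_T : ∀ w v : List S, w ≠ [] → v ≠ [] → ∀ t k,
    Tcov μ u pr r w v (t + k) = Tcov μ u pr r w v t
  letters : ∀ σ σ' : S, σ ≠ σ' → ∀ t, Tcov μ u pr r [σ] [σ'] t = 0
  shift_same : ∀ w v : List S, w ≠ [] → v ≠ [] → ∀ σ : S, (w ++ [σ] ∈ L ∨ v ++ [σ] ∈ L) →
    ∀ t, Tcov μ u pr r (w ++ [σ]) (v ++ [σ]) t = Tcov μ u pr r w v t
  shift_ne : ∀ w v : List S, w ≠ [] → v ≠ [] → ∀ σ σ' : S, σ ≠ σ' →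
    ∀ t, Tcov μ u pr r (w ++ [σ]) (v ++ [σ']) t = 0
  letter_same : ∀ w : List S, w ≠ [] → ∀ σ : S, w ++ [σ] ∈ L →
    ∀ t, Tcov μ u pr r (w ++ [σ]) [σ] t = (Lcov μ u pr r w t)ᵀ
  letter_ne : ∀ w : List S, w ≠ [] → ∀ σ σ' : S, σ ≠ σ' →
    ∀ t, Tcov μ u pr r (w ++ [σ]) [σ'] t = 0
  vanish : ∀ w v : List S, w ≠ [] → v ≠ [] → (w ∉ L ∨ v ∉ L) → ∀ t, Tcov μ u pr r w v t = 0
  vanish_left : ∀ w v : List S, w ≠ [] → v ≠ [] → ∀ σ : S, w ++ [σ] ∈ L → v ++ [σ] ∉ L →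
    ∀ t, Tcov μ u pr r v w t = 0
  vanish_right : ∀ w v : List S, w ≠ [] → v ≠ [] → ∀ σ : S, v ++ [σ] ∈ L → w ++ [σ] ∉ L →
    ∀ t, Tcov μ u pr r v w t = 0

/-- The family `Ψ_y`, indexed by `(j, σ)`: `S_{(j,σ)}(w)` is the `j`-th column of `Λ^y_{σw}`
(evaluated at time `t`). -/
noncomputable def outputSeries (μ : Measure Ω) (u : S → ℤ → Ω → ℝ) (pr : S → ℝ) {p : ℕ}
    (y : ℤ → Ω → Fin p → ℝ) (t : ℤ) : SeriesFamily S (Fin p × S) p :=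
  fun j w i => Lcov μ u pr y (j.2 :: w) t i j.1

end Random

/-! ## Generalized bilinear systems -/

/-- A real square matrix is stable if all its complex eigenvalues lie in the open unit disk. -/
def IsStableMatrix {ι : Type*} [Fintype ι] [DecidableEq ι] (M : Matrix ι ι ℝ) : Prop :=
  ∀ z ∈ spectrum ℂ (M.map (algebraMap ℝ ℂ)), ‖z‖ < 1

/-- A generalized bilinear system with output dimension `p`, driven by the input process `u`:
`x(t+1) = ∑_σ (A_σ x(t) + K_σ v(t)) u_σ(t)`, `y(t) = C x(t) + D v(t)` (almost surely). -/
structure GBS {Ω S : Type*} [MeasurableSpace Ω] [Fintype S] (μ : Measure Ω)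
    (u : S → ℤ → Ω → ℝ) (p : ℕ) where
  /-- the dimension of the system -/
  n : ℕ
  /-- the dimension of the noise -/
  m : ℕ
  A : S → Matrix (Fin n) (Fin n) ℝ
  K : S → Matrix (Fin n) (Fin m) ℝ
  C : Matrix (Fin p) (Fin n) ℝ
  D : Matrix (Fin p) (Fin m) ℝ
  x : ℤ → Ω → Fin n → ℝ
  v : ℤ → Ω → Fin m → ℝ
  aemeasurable_x : ∀ t, AEMeasurable (x t) μ
  aemeasurable_v : ∀ t, AEMeasurable (v t) μ
  state_eq : ∀ t, ∀ᵐ ω ∂μ, x (t + 1) ω = ∑ σ, u σ t ω • (A σ *ᵥ x t ω + K σ *ᵥ v t ω)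

namespace GBS

variable {Ω S : Type*} [MeasurableSpace Ω] [Fintype S] {μ : Measure Ω} {u : S → ℤ → Ω → ℝ} {p : ℕ}

/-- `B` is a realization of `y`. -/
def Realizes (B : GBS μ u p) (y : ℤ → Ω → Fin p → ℝ) : Prop :=
  ∀ t, ∀ᵐ ω ∂μ, y t ω = B.C *ᵥ B.x t ω + B.D *ᵥ B.v t ω

/-- The regularity conditions imposed on a GBS. -/
structure IsRegular (B : GBS μ u p) (pr : S → ℝ) (L : Set (List S)) : Prop where
  noise_rc : IsRC μ u pr L B.v
  noise_orth : ∀ w v : List S, w ≠ [] → v ≠ [] → w ≠ v → ∀ t, Tcov μ u pr B.v w v t = 0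
  state_mem : ∀ t, BelongsTo μ (B.x t) (generatedHilbertSpace μ
    {g | ∃ (w : List S) (j : Fin B.m), w ≠ [] ∧ g = fun ω => zproc u pr B.v w t ω j})
  stable : IsStableMatrix (∑ σ, pr σ • ((B.A σ)ᵀ ⊗ₖ (B.A σ)ᵀ))
  transitions : ∀ σ₁ σ₂ : S, [σ₁, σ₂] ∉ L →
    B.A σ₂ * B.A σ₁ = 0 ∧ ∀ t, B.A σ₂ * B.K σ₁ * Tcov μ u pr B.v [σ₁] [σ₁] t = 0

/-- `B` is a minimal realization of `y`: among all regular realizations of `y` it has the smallest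
dimension. -/
def IsMinimal (B : GBS μ u p) (pr : S → ℝ) (L : Set (List S)) (y : ℤ → Ω → Fin p → ℝ) : Prop :=
  B.IsRegular pr L ∧ B.Realizes y ∧
    ∀ B' : GBS μ u p, B'.IsRegular pr L → B'.Realizes y → B.n ≤ B'.n

/-- `Q_σ = E[v(t) v(t)ᵀ u_σ(t)²]`; for a regular system this does not depend on `t`, and it is
evaluated at `t = 0`. -/
noncomputable def Q (B : GBS μ u p) (σ : S) : Matrix (Fin B.m) (Fin B.m) ℝ :=
  Matrix.of fun i j => ∫ ω, B.v 0 ω i * B.v 0 ω j * (u σ 0 ω) ^ 2 ∂μ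

open Classical in
/-- The Lyapunov-type equation
`P_σ = p_σ ∑_{τ : τσ ∈ L} (A_τ P_τ A_τᵀ + K_τ Q_τ K_τᵀ)` for all `σ`. -/
def IsLyapunovSolution (B : GBS μ u p) (pr : S → ℝ) (L : Set (List S))
    (P : S → Matrix (Fin B.n) (Fin B.n) ℝ) : Prop :=
  ∀ σ, P σ = pr σ • ∑ τ ∈ Finset.univ.filter (fun τ => [τ, σ] ∈ L),
    (B.A τ * P τ * (B.A τ)ᵀ + B.K τ * B.Q τ * (B.K τ)ᵀ)

/-- The solution `{P_σ}` of the Lyapunov-type equation (meaningful when it exists uniquely). -/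
noncomputable def P (B : GBS μ u p) (pr : S → ℝ) (L : Set (List S)) :
    S → Matrix (Fin B.n) (Fin B.n) ℝ :=
  Classical.epsilon (B.IsLyapunovSolution pr L)

/-- `B_σ = (A_σ P_σ Cᵀ + K_σ Q_σ Dᵀ) / √p_σ`. -/
noncomputable def inputMatrix (B : GBS μ u p) (pr : S → ℝ) (L : Set (List S)) (σ : S) :
    Matrix (Fin B.n) (Fin p) ℝ :=
  (1 / √(pr σ)) • (B.A σ * B.P pr L σ * B.Cᵀ + B.K σ * B.Q σ * B.Dᵀ)

/-- The representation `R_B = (ℝⁿ, {√p_σ A_σ}, {B_{σ,j}}, C)` associated with `B`, where `B_{σ,j}`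
is the `j`-th column of `B_σ`. -/
noncomputable def representation (B : GBS μ u p) (pr : S → ℝ) (L : Set (List S)) :
    Representation S (Fin p × S) p where
  dim := B.n
  A := fun σ => √(pr σ) • B.A σ
  B := fun j i => B.inputMatrix pr L j.2 i j.1
  C := B.C

end GBS

end GBSRealization

namespace GBSRealization

/-! ## Reachable and observable representations -/

/-! For every regular realization, the associated representation represents `Ψ_y` and has the
dimension of the system (`GBS.IsRegular.represents`). Minimality of the representation therefore
gives minimality of the system at once. Conversely, it suffices that a minimal system has a
reachable and observable representation: such representations of one family are minimal and
isomorphic to each other.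

Unobservable states form a subspace of `ker C` invariant under all `A_σ`; dividing it out gives a
smaller regular system with the same noise (`GBS.IsRegular.exists_reduction`). Reachability is
harder: the reachable subspace only records covariances of the state with past outputs, and the
noise may drive the state out of it. The system is therefore first replaced by its innovation form,
the Kalman filter: the state is projected onto the Hilbert space of past outputs, and the prediction
error of `y` becomes the noise. `A` and `C` do not change, so stability survives, and the new state
lies almost surely in the reachable subspace, to which the system can be restricted
(`GBS.IsRegular.exists_innovation_reduction`).

All computations take place in one Hilbert space. By stationarity the pasts of `v` at all times are
identified with a single space (`nonempty_noiseModel`), where multiplication by `u_σ/√p_σ` is a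
bounded operator `M_σ` and the shifted noise a tuple `ν_σ`. Different last letters are orthogonal,
and `M_σ` is isometric on the block of `τ` if `τσ` is admissible and zero on it otherwise. The state
process becomes one constant tuple `ξ = ∑ √p_σ (A_σ M_σ ξ + K_σ ν_σ)`; the solution of (1) is `p_σ`
times the Gram matrix of `M_σ ξ`, and `B_σ` is the Gram matrix of `ξ` with the shifted output.
Stability enters as the absence of the eigenvalue 1, which makes (1) uniquely solvable and shows
that the filter state is a function of the innovations. -/

theorem wordProd_append {S : Type*} {n : ℕ} (A : S → Matrix (Fin n) (Fin n) ℝ) (w v : List S) :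
    wordProd A (w ++ v) = wordProd A v * wordProd A w := by
  induction w with
  | nil => simp [wordProd]
  | cons σ w ih => simp [wordProd, ih, Matrix.mul_assoc]

theorem wordProd_append_singleton {S : Type*} {n : ℕ} (A : S → Matrix (Fin n) (Fin n) ℝ)
    (w : List S) (σ : S) : wordProd A (w ++ [σ]) = A σ * wordProd A w := by
  rw [wordProd_append]; simp [wordProd]

/-- The hypothesis `hb` says that the vectors `b i` span: no nonzero functional kills them all. -/
theorem eq_of_forall_dotProduct {n : ℕ} {k : Type*} {M N : Matrix k (Fin n) ℝ} {ι : Type*}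
    {b : ι → Fin n → ℝ}
    (hb : ∀ l : Fin n → ℝ, (∀ i, l ⬝ᵥ b i = 0) → l = 0) (h : ∀ i, M *ᵥ b i = N *ᵥ b i) :
    M = N := by
  ext a c
  have := hb (fun c => M a c - N a c) fun i => by
    have := congrFun (h i) a
    simp only [Matrix.mulVec, dotProduct, sub_mul, Finset.sum_sub_distrib] at this ⊢
    linarith
  exact sub_eq_zero.1 (congrFun this c)

namespace Representation

variable {S J : Type*} {p : ℕ}

/-- The vectors `A_w B_j` span the state space. -/
def IsReachable (R : Representation S J p) : Prop :=
  ∀ l : Fin R.dim → ℝ, (∀ j w, l ⬝ᵥ (wordProd R.A w *ᵥ R.B j) = 0) → l = 0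

/-- Only the zero state produces the zero response. -/
def IsObservable (R : Representation S J p) : Prop :=
  ∀ x : Fin R.dim → ℝ, (∀ w, R.C *ᵥ (wordProd R.A w *ᵥ x) = 0) → x = 0

/-- A linear relation among the reachable vectors of `R'` persists among those of `R`: the same
combination in `R` has zero response, because both realize `Ψ`, so it vanishes by observability.
Hence sending one family of vectors to the other is well defined. -/
theorem IsObservable.exists_intertwiner {R R' : Representation S J p} {Ψ : SeriesFamily S J p}
    (hR : R.Represents Ψ) (ho : R.IsObservable) (hR' : R'.Represents Ψ) :
    ∃ T : Matrix (Fin R.dim) (Fin R'.dim) ℝ,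
      ∀ j w, T *ᵥ (wordProd R'.A w *ᵥ R'.B j) = wordProd R.A w *ᵥ R.B j := by
  classical
  let f := Finsupp.linearCombination ℝ fun i : J × List S => wordProd R.A i.2 *ᵥ R.B i.1
  let f' := Finsupp.linearCombination ℝ fun i : J × List S => wordProd R'.A i.2 *ᵥ R'.B i.1
  have hlin : ∀ v, (Matrix.toLin' (R.C * wordProd R.A v)).comp f
      = (Matrix.toLin' (R'.C * wordProd R'.A v)).comp f' := by
    intro v
    ext ⟨j, w⟩ : 2
    simp only [LinearMap.coe_comp, Function.comp_apply, Finsupp.lsingle_apply, f, f',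
      Finsupp.linearCombination_single, one_smul, Matrix.toLin'_apply]
    have h1 := hR j (w ++ v)
    rw [hR' j (w ++ v)] at h1
    simpa [wordProd_append, Matrix.mulVec_mulVec, Matrix.mul_assoc] using h1.symm
  have hker : ∀ c, f' c = 0 → f c = 0 := fun c hc => ho _ fun v => by
    have := LinearMap.congr_fun (hlin v) c
    simpa [hc, Matrix.mulVec_mulVec] using this
  -- A section `s` of `f'` over its range, extended by `g` to the whole state space; on the range `f
  -- ∘ g` does not depend on the choice, since `ker f' ≤ ker f`.
  obtain ⟨s, hs⟩ := f'.rangeRestrict.exists_rightInverse_of_surjective f'.range_rangeRestrict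
  obtain ⟨g, hg⟩ := LinearMap.exists_extend s
  refine ⟨LinearMap.toMatrix' (f.comp g), fun j w => ?_⟩
  let c : J × List S →₀ ℝ := Finsupp.single (j, w) 1
  have h1 : f' c = wordProd R'.A w *ᵥ R'.B j := by simp [f', c]
  have h2 : f c = wordProd R.A w *ᵥ R.B j := by simp [f, c]
  have h3 : g (f' c) = s (f'.rangeRestrict c) := LinearMap.congr_fun hg (f'.rangeRestrict c)
  have h4 : f' (s (f'.rangeRestrict c)) = f' c :=
    congrArg Subtype.val (LinearMap.congr_fun hs (f'.rangeRestrict c))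
  have h5 := hker (s (f'.rangeRestrict c) - c) (by rw [map_sub, h4, sub_self])
  rw [map_sub, sub_eq_zero] at h5
  rw [LinearMap.toMatrix'_mulVec, ← h1, LinearMap.comp_apply, h3, h5, h2]

/-- The intertwiner from any other representation hits all reachable vectors of `R`, so it is onto
and its transpose is injective. -/
theorem isMinimalOf {R : Representation S J p} {Ψ : SeriesFamily S J p}
    (hR : R.Represents Ψ) (hr : R.IsReachable) (ho : R.IsObservable) : R.IsMinimalOf Ψ := by
  refine ⟨hR, fun R' hR' => ?_⟩
  obtain ⟨T, hT⟩ := ho.exists_intertwiner hR hR'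
  have hinj : Function.Injective (Matrix.toLin' Tᵀ) := by
    rw [injective_iff_map_eq_zero]
    intro l hl
    refine hr l fun j w => ?_
    rw [← hT, Matrix.dotProduct_mulVec, ← Matrix.mulVec_transpose]
    rw [Matrix.toLin'_apply] at hl
    simp [hl]
  simpa using LinearMap.finrank_le_finrank_of_injective hinj

/-- The intertwiners in the two directions are inverse to each other because every identity needed
holds on a spanning set. -/
theorem isomorphic_of_reachable_of_observable {R R' : Representation S J p}
    {Ψ : SeriesFamily S J p} (hR : R.Represents Ψ) (hr : R.IsReachable) (ho : R.IsObservable)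
    (hR' : R'.Represents Ψ) (hr' : R'.IsReachable) (ho' : R'.IsObservable) :
    R.Isomorphic R' := by
  obtain ⟨T, hT⟩ := ho.exists_intertwiner hR hR'
  obtain ⟨T', hT'⟩ := ho'.exists_intertwiner hR' hR
  have hr1 : ∀ l : Fin R.dim → ℝ,
      (∀ i : J × List S, l ⬝ᵥ (wordProd R.A i.2 *ᵥ R.B i.1) = 0) → l = 0 :=
    fun l hl => hr l fun j w => hl (j, w)
  have hr2 : ∀ l : Fin R'.dim → ℝ,
      (∀ i : J × List S, l ⬝ᵥ (wordProd R'.A i.2 *ᵥ R'.B i.1) = 0) → l = 0 :=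
    fun l hl => hr' l fun j w => hl (j, w)
  refine ⟨le_antisymm ((isMinimalOf hR hr ho).2 R' hR') ((isMinimalOf hR' hr' ho').2 R hR),
    T, T', ?_, ?_, fun σ => ?_, fun j => ?_, ?_⟩
  · refine eq_of_forall_dotProduct hr1 fun i => ?_
    rw [← Matrix.mulVec_mulVec, hT', hT, Matrix.one_mulVec]
  · refine eq_of_forall_dotProduct hr2 fun i => ?_
    rw [← Matrix.mulVec_mulVec, hT, hT', Matrix.one_mulVec]
  · refine eq_of_forall_dotProduct hr2 fun i => ?_
    have := hT i.1 (i.2 ++ [σ])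
    rw [wordProd_append, wordProd_append] at this
    simp only [wordProd, one_mul, ← Matrix.mulVec_mulVec] at this
    rw [← Matrix.mulVec_mulVec, this, ← Matrix.mulVec_mulVec, hT]
  · simpa [wordProd] using hT j []
  · refine eq_of_forall_dotProduct hr2 fun i => ?_
    rw [← Matrix.mulVec_mulVec, hT, ← hR, ← hR']

end Representation

/-! ## Stability and the Lyapunov-type equation -/

theorem IsStableMatrix.isUnit_one_sub {ι : Type*} [Fintype ι] [DecidableEq ι]
    {M : Matrix ι ι ℝ} (hM : IsStableMatrix M) : IsUnit (1 - M) := by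
  have h1 : (1 : ℂ) ∉ spectrum ℂ (M.map (algebraMap ℝ ℂ)) := fun h => by
    simpa using hM 1 h
  rw [spectrum.notMem_iff, map_one, Matrix.isUnit_iff_isUnit_det, isUnit_iff_ne_zero] at h1
  rw [Matrix.isUnit_iff_isUnit_det, isUnit_iff_ne_zero]
  intro h
  apply h1
  have := RingHom.map_det (algebraMap ℝ ℂ) (1 - M)
  rw [h, map_zero, map_sub, map_one] at this
  exact this.symm

/-- `M'` is a restriction or a quotient of `M`. If `N` inverts `z - M`, then `P N R` is a one-sided
inverse of `z - M'`, which suffices for square matrices. -/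
theorem IsStableMatrix.of_intertwining {ι κ : Type*} [Fintype ι] [DecidableEq ι] [Fintype κ]
    [DecidableEq κ] {M : Matrix ι ι ℝ} {M' : Matrix κ κ ℝ} (hM : IsStableMatrix M)
    (P : Matrix κ ι ℝ) (R : Matrix ι κ ℝ) (hPR : P * R = 1)
    (h : M * R = R * M' ∨ P * M = M' * P) : IsStableMatrix M' := by
  intro z hz
  refine hM z fun hz' => hz ?_
  set φ := algebraMap ℝ ℂ
  obtain ⟨N, hN⟩ := hz'
  have hN1 : (N⁻¹ : (Matrix ι ι ℂ)ˣ).1 * (algebraMap ℂ _ z - M.map φ) = 1 := by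
    rw [← hN]; simp
  have hN2 : (algebraMap ℂ _ z - M.map φ) * (N⁻¹ : (Matrix ι ι ℂ)ˣ).1 = 1 := by
    rw [← hN]; simp
  have hPR' : P.map φ * R.map φ = 1 := by
    rw [← Matrix.map_mul, hPR, Matrix.map_one _ (map_zero φ) (map_one φ)]
  rcases h with h | h
  · have h' : M.map φ * R.map φ = R.map φ * M'.map φ := by
      rw [← Matrix.map_mul, h, Matrix.map_mul]
    refine IsUnit.of_mul_eq_one_right (P.map φ * N⁻¹.1 * R.map φ) ?_
    have : R.map φ * (algebraMap ℂ _ z - M'.map φ)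
        = (algebraMap ℂ _ z - M.map φ) * R.map φ := by
      rw [Matrix.mul_sub, Matrix.sub_mul, h', Algebra.algebraMap_eq_smul_one,
        Algebra.algebraMap_eq_smul_one]
      simp
    rw [Matrix.mul_assoc, this, Matrix.mul_assoc, ← Matrix.mul_assoc N⁻¹.1, hN1, Matrix.one_mul,
      hPR']
  · have h' : P.map φ * M.map φ = M'.map φ * P.map φ := by
      rw [← Matrix.map_mul, h, Matrix.map_mul]
    refine IsUnit.of_mul_eq_one (P.map φ * N⁻¹.1 * R.map φ) ?_
    have : (algebraMap ℂ _ z - M'.map φ) * P.map φ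
        = P.map φ * (algebraMap ℂ _ z - M.map φ) := by
      rw [Matrix.mul_sub, Matrix.sub_mul, h', Algebra.algebraMap_eq_smul_one,
        Algebra.algebraMap_eq_smul_one]
      simp
    rw [← Matrix.mul_assoc, ← Matrix.mul_assoc, this, Matrix.mul_assoc (P.map φ), hN2,
      Matrix.mul_one, hPR']

section

variable {S : Type*} [Fintype S] {n : ℕ} {pr : S → ℝ} {A : S → Matrix (Fin n) (Fin n) ℝ}

/-- The alternatives are restriction to an invariant subspace and passage to a quotient; the
transposes in the Kronecker products exchange them. -/
theorem IsStableMatrix.reduce {r : ℕ}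
    (hA : IsStableMatrix (∑ σ, pr σ • ((A σ)ᵀ ⊗ₖ (A σ)ᵀ)))
    (U : Matrix (Fin r) (Fin n) ℝ) (T : Matrix (Fin n) (Fin r) ℝ) (hUT : U * T = 1)
    (h : (∀ σ, T * (U * A σ * T) = A σ * T) ∨ (∀ σ, U * A σ * T * U = U * A σ)) :
    IsStableMatrix (∑ σ, pr σ • ((U * A σ * T)ᵀ ⊗ₖ (U * A σ * T)ᵀ)) := by
  refine hA.of_intertwining (Tᵀ ⊗ₖ Tᵀ) (Uᵀ ⊗ₖ Uᵀ) ?_ ?_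
  · rw [← Matrix.mul_kronecker_mul, ← Matrix.transpose_mul, hUT]; simp
  rcases h with h | h
  · right
    simp only [Matrix.mul_sum, Matrix.sum_mul, Matrix.mul_smul, Matrix.smul_mul,
      ← Matrix.mul_kronecker_mul, ← Matrix.transpose_mul, h]
  · left
    simp only [Matrix.mul_sum, Matrix.sum_mul, Matrix.mul_smul, Matrix.smul_mul,
      ← Matrix.mul_kronecker_mul, ← Matrix.transpose_mul, h]

/-- After vectorization `X` is a fixed vector of the transposed Kronecker sum, and 1 is not an
eigenvalue. -/
theorem eq_zero_of_eq_sum_congruence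
    (hA : IsStableMatrix (∑ σ, pr σ • ((A σ)ᵀ ⊗ₖ (A σ)ᵀ))) {X : Matrix (Fin n) (Fin n) ℝ}
    (hX : X = ∑ σ, pr σ • (A σ * X * (A σ)ᵀ)) : X = 0 := by
  have h1 := hA.isUnit_one_sub
  rw [← Matrix.isUnit_transpose] at h1
  have h2 : (1 - ∑ σ, pr σ • ((A σ)ᵀ ⊗ₖ (A σ)ᵀ))ᵀ *ᵥ X.vec = 0 := by
    rw [Matrix.transpose_sub, Matrix.sub_mulVec, Matrix.transpose_one, Matrix.one_mulVec,
      Matrix.transpose_sum, Matrix.sum_mulVec, sub_eq_zero]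
    simp only [Matrix.transpose_smul, Matrix.smul_mulVec, Matrix.kroneckerMap_transpose,
      Matrix.transpose_transpose, Matrix.kronecker_mulVec_vec]
    conv_lhs => rw [hX]
    simp [Matrix.vec_sum, Matrix.vec_smul]
  rw [← Matrix.vec_eq_zero_iff]
  have := Matrix.mulVec_injective_of_isUnit h1
  exact this (by rw [h2, Matrix.mulVec_zero])

open Classical in
-- Conjugating by `A σ` makes the restriction to admissible pairs disappear, since `A σ * A τ = 0`
-- for the others. The full sum `X = ∑ A τ P τ (A τ)ᵀ` then satisfies `X = ∑ p_σ A_σ X A_σᵀ`, so it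
-- vanishes, and each `P σ` with it.
theorem lyapunov_homogeneous_eq_zero {L : Set (List S)}
    (hA : IsStableMatrix (∑ σ, pr σ • ((A σ)ᵀ ⊗ₖ (A σ)ᵀ)))
    (hL : ∀ τ σ : S, [τ, σ] ∉ L → A σ * A τ = 0) {P : S → Matrix (Fin n) (Fin n) ℝ}
    (hP : ∀ σ, P σ = pr σ • ∑ τ ∈ Finset.univ.filter (fun τ => [τ, σ] ∈ L),
      A τ * P τ * (A τ)ᵀ) : P = 0 := by
  have h1 : ∀ σ, A σ * P σ * (A σ)ᵀ
      = pr σ • (A σ * (∑ τ, A τ * P τ * (A τ)ᵀ) * (A σ)ᵀ) := by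
    intro σ
    conv_lhs => rw [hP σ]
    rw [Matrix.mul_smul, Matrix.smul_mul, Matrix.mul_sum, Matrix.mul_sum, Finset.sum_filter]
    congr 2
    refine Finset.sum_congr rfl fun τ _ => ?_
    split_ifs with h
    · rfl
    · rw [← Matrix.mul_assoc, ← Matrix.mul_assoc, hL τ σ h]; simp
  have h2 : ∑ τ, A τ * P τ * (A τ)ᵀ = 0 := by
    apply eq_zero_of_eq_sum_congruence hA
    exact Finset.sum_congr rfl fun σ _ => h1 σ
  funext σ
  rw [hP σ, Finset.sum_eq_zero, smul_zero]; · rfl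
  intro τ _
  rw [h1, h2]; simp

open Classical in
theorem existsUnique_lyapunov {L : Set (List S)}
    (hA : IsStableMatrix (∑ σ, pr σ • ((A σ)ᵀ ⊗ₖ (A σ)ᵀ)))
    (hL : ∀ τ σ : S, [τ, σ] ∉ L → A σ * A τ = 0) (N : S → Matrix (Fin n) (Fin n) ℝ) :
    ∃! P : S → Matrix (Fin n) (Fin n) ℝ,
      ∀ σ, P σ = pr σ • ∑ τ ∈ Finset.univ.filter (fun τ => [τ, σ] ∈ L),
        (A τ * P τ * (A τ)ᵀ + N τ) := by
  let Φ : (S → Matrix (Fin n) (Fin n) ℝ) →ₗ[ℝ] (S → Matrix (Fin n) (Fin n) ℝ) :=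
    { toFun := fun P σ => P σ - pr σ • ∑ τ ∈ Finset.univ.filter (fun τ => [τ, σ] ∈ L),
        A τ * P τ * (A τ)ᵀ
      map_add' := fun P P' => by
        funext σ
        simp only [Pi.add_apply, Matrix.mul_add, Matrix.add_mul, Finset.sum_add_distrib, smul_add]
        abel
      map_smul' := fun c P => by
        funext σ
        simp only [Pi.smul_apply, Matrix.mul_smul, Matrix.smul_mul, ← Finset.smul_sum, smul_sub,
          RingHom.id_apply, smul_comm c (pr σ)] }
  have hinj : Function.Injective Φ := by
    rw [injective_iff_map_eq_zero]
    intro P hP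
    exact lyapunov_homogeneous_eq_zero hA hL fun σ => sub_eq_zero.1 (congrFun hP σ)
  have key : ∀ P : S → Matrix (Fin n) (Fin n) ℝ,
      (∀ σ, P σ = pr σ • ∑ τ ∈ Finset.univ.filter (fun τ => [τ, σ] ∈ L),
        (A τ * P τ * (A τ)ᵀ + N τ)) ↔
      Φ P = fun σ => pr σ • ∑ τ ∈ Finset.univ.filter (fun τ => [τ, σ] ∈ L), N τ := by
    intro P
    rw [funext_iff]
    refine forall_congr' fun σ => ?_
    simp only [Φ, LinearMap.coe_mk, AddHom.coe_mk, Finset.sum_add_distrib, smul_add,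
      sub_eq_iff_eq_add']
  simp only [key]
  exact Function.Bijective.existsUnique ⟨hinj, LinearMap.injective_iff_surjective.1 hinj⟩ _

end

/-! ## Vectors with entries in a Hilbert space -/

section Gram

variable {E : Type*} [NormedAddCommGroup E] [InnerProductSpace ℝ E]
  {F : Type*} [NormedAddCommGroup F] [InnerProductSpace ℝ F] {a b c : ℕ}

/-- The product of a real matrix and a column vector with entries in `E`. -/
def matAct (A : Matrix (Fin a) (Fin b) ℝ) (ξ : Fin b → E) : Fin a → E :=
  fun i => ∑ j, A i j • ξ j

/-- The matrix of inner products of the entries of `ξ` and `ζ`. -/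
noncomputable def crossGram (ξ : Fin a → E) (ζ : Fin b → E) : Matrix (Fin a) (Fin b) ℝ :=
  Matrix.of fun i j => inner ℝ (ξ i) (ζ j)

theorem crossGram_apply (ξ : Fin a → E) (ζ : Fin b → E) (i : Fin a) (j : Fin b) :
    crossGram ξ ζ i j = inner ℝ (ξ i) (ζ j) := rfl

theorem crossGram_transpose (ξ : Fin a → E) (ζ : Fin b → E) :
    (crossGram ξ ζ)ᵀ = crossGram ζ ξ := by
  ext i j; simp [crossGram_apply, real_inner_comm]

theorem crossGram_add_left (ξ ξ' : Fin a → E) (ζ : Fin b → E) :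
    crossGram (ξ + ξ') ζ = crossGram ξ ζ + crossGram ξ' ζ := by
  ext i j; simp [crossGram_apply, inner_add_left]

theorem crossGram_add_right (ξ : Fin a → E) (ζ ζ' : Fin b → E) :
    crossGram ξ (ζ + ζ') = crossGram ξ ζ + crossGram ξ ζ' := by
  ext i j; simp [crossGram_apply, inner_add_right]

theorem crossGram_sub_left (ξ ξ' : Fin a → E) (ζ : Fin b → E) :
    crossGram (ξ - ξ') ζ = crossGram ξ ζ - crossGram ξ' ζ := by
  ext i j; simp [crossGram_apply, inner_sub_left]

theorem crossGram_smul_left (r : ℝ) (ξ : Fin a → E) (ζ : Fin b → E) :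
    crossGram (r • ξ) ζ = r • crossGram ξ ζ := by
  ext i j; simp [crossGram_apply, real_inner_smul_left]

theorem crossGram_smul_right (r : ℝ) (ξ : Fin a → E) (ζ : Fin b → E) :
    crossGram ξ (r • ζ) = r • crossGram ξ ζ := by
  ext i j; simp [crossGram_apply, real_inner_smul_right]

theorem crossGram_sum_left {ι : Type*} (s : Finset ι) (ξ : ι → Fin a → E) (ζ : Fin b → E) :
    crossGram (∑ k ∈ s, ξ k) ζ = ∑ k ∈ s, crossGram (ξ k) ζ := by
  ext i j; simp [crossGram_apply, sum_inner, Matrix.sum_apply]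

theorem crossGram_sum_right {ι : Type*} (s : Finset ι) (ξ : Fin a → E) (ζ : ι → Fin b → E) :
    crossGram ξ (∑ k ∈ s, ζ k) = ∑ k ∈ s, crossGram ξ (ζ k) := by
  ext i j; simp [crossGram_apply, inner_sum, Matrix.sum_apply]

theorem crossGram_matAct_left (A : Matrix (Fin a) (Fin b) ℝ) (ξ : Fin b → E) (ζ : Fin c → E) :
    crossGram (matAct A ξ) ζ = A * crossGram ξ ζ := by
  ext i j; simp [crossGram_apply, matAct, sum_inner, Matrix.mul_apply, real_inner_smul_left]

theorem crossGram_matAct_right (A : Matrix (Fin a) (Fin b) ℝ) (ξ : Fin c → E) (ζ : Fin b → E) :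
    crossGram ξ (matAct A ζ) = crossGram ξ ζ * Aᵀ := by
  rw [← crossGram_transpose, crossGram_matAct_left, Matrix.transpose_mul, crossGram_transpose]

theorem eq_zero_of_crossGram_self {ξ : Fin a → E} (h : crossGram ξ ξ = 0) : ξ = 0 := by
  funext i
  have := congrFun (congrFun h i) i
  simpa [crossGram_apply] using this

theorem matAct_mem (K : Submodule ℝ E) (A : Matrix (Fin a) (Fin b) ℝ) {ξ : Fin b → E}
    (h : ∀ j, ξ j ∈ K) (i : Fin a) : matAct A ξ i ∈ K :=
  K.sum_mem fun j _ => K.smul_mem _ (h j)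

theorem matAct_sub (A : Matrix (Fin a) (Fin b) ℝ) (ξ ζ : Fin b → E) :
    matAct A (ξ - ζ) = matAct A ξ - matAct A ζ := by
  funext i; simp [matAct, smul_sub]

theorem map_comp_sub (f : E →L[ℝ] F) (ξ ζ : Fin a → E) : f ∘ (ξ - ζ) = f ∘ ξ - f ∘ ζ := by
  funext i; simp

theorem map_comp_smul (f : E →L[ℝ] F) (r : ℝ) (ξ : Fin a → E) : f ∘ (r • ξ) = r • (f ∘ ξ) := by
  funext i; simp

theorem map_comp_sum (f : E →L[ℝ] F) {ι : Type*} (s : Finset ι) (ξ : ι → Fin a → E) :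
    f ∘ (∑ k ∈ s, ξ k) = ∑ k ∈ s, f ∘ ξ k := by
  funext i; simp

/-- Orthogonal projection of a vector onto the span of the entries of another one. -/
theorem exists_matAct_orthogonal (ξ : Fin a → E) (ε : Fin b → E) :
    ∃ K : Matrix (Fin a) (Fin b) ℝ, ∀ i j, inner ℝ ((ξ - matAct K ε) i) (ε j) = 0 := by
  have h : ∀ i, ∃ k : Fin b → ℝ, ∀ j, inner ℝ (ξ i - ∑ l, k l • ε l) (ε j) = 0 := by
    intro i
    have := FiniteDimensional.span_of_finite ℝ (Set.finite_range ε)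
    obtain ⟨w, hw, hw'⟩ := Submodule.HasOrthogonalProjection.exists_orthogonal
      (K := Submodule.span ℝ (Set.range ε)) (ξ i)
    obtain ⟨k, rfl⟩ := (Submodule.mem_span_range_iff_exists_fun ℝ).1 hw
    refine ⟨k, fun j => ?_⟩
    exact (Submodule.mem_orthogonal' _ _).1 hw' _ (Submodule.subset_span ⟨j, rfl⟩)
  choose k hk using h
  exact ⟨Matrix.of k, hk⟩

end Gram

/-! ## Shift systems

The Hilbert space of the past of a white noise process, identified for all times, with the
operators of multiplication by the inputs and the new directions brought in by the noise. -/

section Shift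

variable {S E : Type*} [NormedAddCommGroup E] [InnerProductSpace ℝ E] {m : ℕ}

/-- The operators `M σ` and the vectors `ν σ` are compatible with the admissible words. -/
structure IsShiftSystem (L : Set (List S)) (M : S → E →L[ℝ] E) (ν : S → Fin m → E) : Prop where
  inner_map_map : ∀ σ τ, σ ≠ τ → ∀ f g, inner ℝ (M σ f) (M τ g) = 0
  inner_map_noise : ∀ σ τ f j, inner ℝ (M σ f) (ν τ j) = 0
  inner_noise_noise : ∀ σ τ, σ ≠ τ → ∀ i j, inner ℝ (ν σ i) (ν τ j) = 0
  map_map : ∀ τ σ, [τ, σ] ∉ L → ∀ f, M σ (M τ f) = 0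
  map_noise : ∀ τ σ, [τ, σ] ∉ L → ∀ j, M σ (ν τ j) = 0
  inner_map_map_map : ∀ τ σ, [τ, σ] ∈ L → ∀ f g,
    inner ℝ (M σ (M τ f)) (M σ g) = inner ℝ (M τ f) g
  inner_map_map_noise : ∀ τ σ, [τ, σ] ∈ L → ∀ j g,
    inner ℝ (M σ (ν τ j)) (M σ g) = inner ℝ (ν τ j) g

/-- The subspace of the vectors whose last letter is `σ`. -/
def block (M : S → E →L[ℝ] E) (ν : S → Fin m → E) (σ : S) : Submodule ℝ E :=
  LinearMap.range (M σ : E →ₗ[ℝ] E) ⊔ Submodule.span ℝ (Set.range (ν σ))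

/-- `M_w f = M_{σₖ} ⋯ M_{σ₁} f` for `w = σ₁ ⋯ σₖ`. -/
def wordApply (M : S → E →L[ℝ] E) (w : List S) (f : E) : E := w.foldl (fun f τ => M τ f) f

/-- The closed linear span of the vectors `M_w ζ_{σ,j}`. -/
def cyc (M : S → E →L[ℝ] E) {k : ℕ} (ζ : S → Fin k → E) : Submodule ℝ E :=
  (Submodule.span ℝ {f | ∃ σ w j, f = wordApply M w (ζ σ j)}).topologicalClosure

variable {L : Set (List S)} {M : S → E →L[ℝ] E} {ν : S → Fin m → E} {k : ℕ} {ζ : S → Fin k → E}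

theorem map_mem_block (σ : S) (f : E) : M σ f ∈ block M ν σ :=
  Submodule.mem_sup_left ⟨f, rfl⟩

theorem noise_mem_block (σ : S) (j : Fin m) : ν σ j ∈ block M ν σ :=
  Submodule.mem_sup_right (Submodule.subset_span ⟨j, rfl⟩)

theorem block_le {σ : S} {K : Submodule ℝ E} (h1 : ∀ f, M σ f ∈ K) (h2 : ∀ j, ν σ j ∈ K) :
    block M ν σ ≤ K := by
  refine sup_le ?_ (Submodule.span_le.2 ?_)
  · rintro _ ⟨f, rfl⟩; exact h1 f
  · rintro _ ⟨j, rfl⟩; exact h2 j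

theorem wordApply_append_singleton (w : List S) (τ : S) (f : E) :
    wordApply M (w ++ [τ]) f = M τ (wordApply M w f) := by
  simp [wordApply]

theorem wordApply_mem_block {σ : S} {f : E} (hf : f ∈ block M ν σ) (w : List S) :
    wordApply M w f ∈ block M ν ((σ :: w).getLast (by simp)) := by
  induction w using List.reverseRecOn with
  | nil => simpa [wordApply]
  | append_singleton w τ _ =>
    rw [wordApply_append_singleton]
    have : (σ :: (w ++ [τ])).getLast (by simp) = τ := by
      simp
    rw [this]
    exact map_mem_block _ _

theorem wordApply_mem_cyc (σ : S) (w : List S) (j : Fin k) :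
    wordApply M w (ζ σ j) ∈ cyc M ζ :=
  Submodule.le_topologicalClosure _ (Submodule.subset_span ⟨σ, w, j, rfl⟩)

theorem mem_cyc (σ : S) (j : Fin k) : ζ σ j ∈ cyc M ζ := wordApply_mem_cyc σ [] j

theorem isClosed_cyc : IsClosed (cyc M ζ : Set E) := Submodule.isClosed_topologicalClosure _

theorem cyc_le {K : Submodule ℝ E} (hK : IsClosed (K : Set E))
    (h : ∀ σ w j, wordApply M w (ζ σ j) ∈ K) : cyc M ζ ≤ K := by
  refine Submodule.topologicalClosure_minimal _ (Submodule.span_le.2 ?_) hK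
  rintro _ ⟨σ, w, j, rfl⟩
  exact h σ w j

theorem map_mem_cyc (τ : S) {f : E} (hf : f ∈ cyc M ζ) : M τ f ∈ cyc M ζ := by
  have : cyc M ζ ≤ (cyc M ζ).comap (M τ : E →ₗ[ℝ] E) := by
    refine cyc_le (isClosed_cyc.preimage (M τ).continuous) fun σ w j => ?_
    have := wordApply_mem_cyc (M := M) (ζ := ζ) σ (w ++ [τ]) j
    rwa [wordApply_append_singleton] at this
  exact this hf

theorem wordApply_mem_cyc_of_mem {f : E} (hf : f ∈ cyc M ζ) (w : List S) :
    wordApply M w f ∈ cyc M ζ := by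
  induction w using List.reverseRecOn with
  | nil => exact hf
  | append_singleton w τ ih => rw [wordApply_append_singleton]; exact map_mem_cyc τ ih

theorem inner_eq_zero_of_mem_cyc {f : E} (B : E →L[ℝ] E)
    (h : ∀ σ w j, inner ℝ f (B (wordApply M w (ζ σ j))) = 0) {g : E} (hg : g ∈ cyc M ζ) :
    inner ℝ f (B g) = 0 := by
  have : cyc M ζ ≤ LinearMap.ker (((innerSL ℝ f).comp B : E →L[ℝ] ℝ) : E →ₗ[ℝ] ℝ) :=
    cyc_le (ContinuousLinearMap.isClosed_ker _) fun σ w j => by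
      simpa using h σ w j
  simpa using this hg

namespace IsShiftSystem

variable (hM : IsShiftSystem L M ν)

include hM

theorem inner_block_block {σ τ : S} (h : σ ≠ τ) {f g : E} (hf : f ∈ block M ν σ)
    (hg : g ∈ block M ν τ) : inner ℝ f g = 0 := by
  have h1 : ∀ f ∈ block M ν σ, ∀ g, inner ℝ f (M τ g) = 0 := fun f hf g => by
    have : block M ν σ ≤ LinearMap.ker ((innerSL ℝ (M τ g) : E →L[ℝ] ℝ) : E →ₗ[ℝ] ℝ) :=
      block_le (fun f => by simpa using hM.inner_map_map τ σ h.symm g f)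
        (fun j => by simpa using hM.inner_map_noise τ σ g j)
    rw [real_inner_comm]; simpa using this hf
  have h2 : ∀ f ∈ block M ν σ, ∀ j, inner ℝ f (ν τ j) = 0 := fun f hf j => by
    have : block M ν σ ≤ LinearMap.ker ((innerSL ℝ (ν τ j) : E →L[ℝ] ℝ) : E →ₗ[ℝ] ℝ) :=
      block_le (fun f => by simpa [real_inner_comm] using hM.inner_map_noise σ τ f j)
        (fun i => by simpa using hM.inner_noise_noise τ σ h.symm j i)
    rw [real_inner_comm]; simpa using this hf
  have : block M ν τ ≤ LinearMap.ker ((innerSL ℝ f : E →L[ℝ] ℝ) : E →ₗ[ℝ] ℝ) :=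
    block_le (fun g => by simpa using h1 f hf g) (fun j => by simpa using h2 f hf j)
  simpa using this hg

theorem map_block {τ σ : S} (h : [τ, σ] ∉ L) {f : E} (hf : f ∈ block M ν τ) : M σ f = 0 := by
  have : block M ν τ ≤ LinearMap.ker (M σ : E →ₗ[ℝ] E) :=
    block_le (fun f => by simpa using hM.map_map τ σ h f)
      (fun j => by simpa using hM.map_noise τ σ h j)
  simpa using this hf

/-- With `map_block`: `M_σ* M_σ` is the identity on the blocks `τ` with `τσ` admissible and zero on
the others. That `g` is arbitrary makes this stronger than isometry on a block. -/
theorem inner_map_block {τ σ : S} (h : [τ, σ] ∈ L) {f : E} (hf : f ∈ block M ν τ) (g : E) :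
    inner ℝ (M σ f) (M σ g) = inner ℝ f g := by
  have : block M ν τ ≤ LinearMap.ker ((((innerSL ℝ (M σ g)).comp (M σ) - innerSL ℝ g :
      E →L[ℝ] ℝ)) : E →ₗ[ℝ] ℝ) :=
    block_le
      (fun f => by
        have := hM.inner_map_map_map τ σ h f g
        rw [real_inner_comm (M σ g), real_inner_comm g] at this
        simp [this])
      (fun j => by
        have := hM.inner_map_map_noise τ σ h j g
        rw [real_inner_comm (M σ g), real_inner_comm g] at this
        simp [this])
  have h2 := this hf
  simp only [LinearMap.mem_ker, ContinuousLinearMap.coe_coe, sub_apply,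
    ContinuousLinearMap.comp_apply, innerSL_apply_apply, sub_eq_zero] at h2
  rw [real_inner_comm, h2, real_inner_comm]

/-- Orthogonality to a cyclic space survives one more letter, as `M_σ* M_σ` fixes or kills each
generator `M_w ζ`. -/
theorem inner_map_map_eq_zero (hζ : ∀ σ j, ζ σ j ∈ block M ν σ) {f : E}
    (hf : ∀ σ w j, inner ℝ f (wordApply M w (ζ σ j)) = 0) (σ τ : S) {g : E}
    (hg : g ∈ cyc M ζ) : inner ℝ (M σ f) (M τ g) = 0 := by
  by_cases h : σ = τ
  · subst h
    refine inner_eq_zero_of_mem_cyc (M σ) (fun ρ w j => ?_) hg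
    have hb := wordApply_mem_block (hζ ρ j) w
    by_cases hL : [(ρ :: w).getLast (by simp), σ] ∈ L
    · rw [real_inner_comm, hM.inner_map_block hL hb, real_inner_comm, hf]
    · rw [hM.map_block hL hb, inner_zero_right]
  · exact hM.inner_map_map σ τ h f g

/-- Common last letters are stripped off until the last letters differ, which gives orthogonality of
blocks, or one word is a single letter, where `hw` applies. -/
theorem inner_wordApply_of_ne (hζ : ∀ σ j, ζ σ j ∈ block M ν σ)
    (hw : ∀ σ τ w ρ i j, inner ℝ (ζ σ i) (M τ (wordApply M w (ζ ρ j))) = 0)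
    {σ σ' : S} {w w' : List S} (h : σ :: w ≠ σ' :: w') (i j : Fin k) :
    inner ℝ (wordApply M w (ζ σ i)) (wordApply M w' (ζ σ' j)) = 0 := by
  induction w using List.reverseRecOn generalizing w' with
  | nil =>
    induction w' using List.reverseRecOn with
    | nil =>
      refine hM.inner_block_block ?_ (hζ σ i) (hζ σ' j)
      rintro rfl; exact h rfl
    | append_singleton w' τ _ => rw [wordApply_append_singleton]; exact hw σ τ w' σ' i j
  | append_singleton w τ ih =>
    induction w' using List.reverseRecOn with
    | nil => rw [wordApply_append_singleton, real_inner_comm]; exact hw σ' τ w σ j i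
    | append_singleton w' τ' _ =>
      rw [wordApply_append_singleton, wordApply_append_singleton]
      by_cases hτ : τ = τ'
      · subst hτ
        have hb := wordApply_mem_block (hζ σ i) w
        by_cases hL : [(σ :: w).getLast (by simp), τ] ∈ L
        · rw [hM.inner_map_block hL hb]
          refine ih fun h' => h ?_
          rw [← List.cons_append, h', List.cons_append]
        · rw [hM.map_block hL hb, inner_zero_left]
      · exact hM.inner_map_map τ τ' hτ _ _

end IsShiftSystem

end Shift

/-! ## State vectors in a shift system -/

section State

variable {S E : Type*} [Fintype S] [NormedAddCommGroup E] [InnerProductSpace ℝ E] {m n p k : ℕ}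
  {L : Set (List S)} {M : S → E →L[ℝ] E} {ν : S → Fin m → E} {pr : S → ℝ}
  {A : S → Matrix (Fin n) (Fin n) ℝ} {K : S → Matrix (Fin n) (Fin m) ℝ} {ξ : Fin n → E}

/-- `ξ` solves the stationary state equation `ξ = ∑_σ √p_σ (A_σ M_σ ξ + K_σ ν_σ)`. -/
def IsState (M : S → E →L[ℝ] E) (ν : S → Fin m → E) (pr : S → ℝ)
    (A : S → Matrix (Fin n) (Fin n) ℝ) (K : S → Matrix (Fin n) (Fin m) ℝ) (ξ : Fin n → E) : Prop :=
  ξ = ∑ σ, √(pr σ) • (matAct (A σ) (M σ ∘ ξ) + matAct (K σ) (ν σ))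

omit [Fintype S] in
theorem matAct_add_matAct_mem_block (A : Matrix (Fin k) (Fin n) ℝ) (D : Matrix (Fin k) (Fin m) ℝ)
    (σ : S) (ξ : Fin n → E) (i : Fin k) :
    (matAct A (M σ ∘ ξ) + matAct D (ν σ)) i ∈ block M ν σ :=
  Submodule.add_mem _ (matAct_mem _ A (fun j => map_mem_block σ (ξ j)) i)
    (matAct_mem _ D (fun j => noise_mem_block σ j) i)

namespace IsShiftSystem

variable (hM : IsShiftSystem L M ν)

include hM

omit [Fintype S] in
theorem crossGram_map_noise (σ τ : S) (ξ : Fin n → E) : crossGram (M σ ∘ ξ) (ν τ) = 0 := by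
  ext i j; exact hM.inner_map_noise σ τ (ξ i) j

omit [Fintype S] in
theorem crossGram_noise_map (σ τ : S) (ξ : Fin n → E) : crossGram (ν τ) (M σ ∘ ξ) = 0 := by
  rw [← crossGram_transpose, hM.crossGram_map_noise, Matrix.transpose_zero]

/-- The old state `ξ` and the new state `ξ'` are kept apart so that the formula applies before the
state is known to be constant in time. -/
theorem crossGram_step {ξ' : Fin n → E}
    (hξ : ξ' = ∑ σ, √(pr σ) • (matAct (A σ) (M σ ∘ ξ) + matAct (K σ) (ν σ))) {σ : S}
    {f : Fin k → E} (hf : ∀ j, f j ∈ block M ν σ) :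
    crossGram ξ' f = √(pr σ) • (A σ * crossGram (M σ ∘ ξ) f + K σ * crossGram (ν σ) f) := by
  rw [hξ]
  rw [crossGram_sum_left, Finset.sum_eq_single σ]
  · rw [crossGram_smul_left, crossGram_add_left, crossGram_matAct_left, crossGram_matAct_left]
  · intro τ _ hτ
    rw [crossGram_smul_left]
    convert smul_zero _
    ext i j
    exact hM.inner_block_block hτ (matAct_add_matAct_mem_block _ _ _ _ _) (hf j)
  · simp

theorem crossGram_state (hξ : IsState M ν pr A K ξ) {σ : S} {f : Fin k → E}
    (hf : ∀ j, f j ∈ block M ν σ) :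
    crossGram ξ f = √(pr σ) • (A σ * crossGram (M σ ∘ ξ) f + K σ * crossGram (ν σ) f) :=
  hM.crossGram_step hξ hf

theorem crossGram_state_output (hξ : IsState M ν pr A K ξ) (C : Matrix (Fin p) (Fin n) ℝ)
    (D : Matrix (Fin p) (Fin m) ℝ) (σ : S) :
    crossGram ξ (matAct C (M σ ∘ ξ) + matAct D (ν σ)) = √(pr σ) •
      (A σ * crossGram (M σ ∘ ξ) (M σ ∘ ξ) * Cᵀ + K σ * crossGram (ν σ) (ν σ) * Dᵀ) := by
  rw [hM.crossGram_state hξ (matAct_add_matAct_mem_block C D σ ξ)]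
  simp only [crossGram_add_right, crossGram_matAct_right, hM.crossGram_map_noise,
    hM.crossGram_noise_map, Matrix.mul_assoc, Matrix.zero_mul, add_zero, zero_add]

/-- Only `A_τ K_σ ⟨ν_σ, f⟩` could survive; it vanishes on the range of `M_σ` by orthogonality and on
the noise by `h2`, hence on the whole block. -/
theorem mul_crossGram_state_eq_zero (hξ : IsState M ν pr A K ξ) {σ τ : S}
    (h1 : A τ * A σ = 0) (h2 : A τ * K σ * crossGram (ν σ) (ν σ) = 0) {f : Fin k → E}
    (hf : ∀ j, f j ∈ block M ν σ) : A τ * crossGram ξ f = 0 := by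
  have key : ∀ f ∈ block M ν σ, ∀ i, ∑ l, (A τ * K σ) i l * inner ℝ (ν σ l) f = 0 := by
    intro f hf i
    have : block M ν σ ≤ LinearMap.ker ((∑ l, (A τ * K σ) i l • innerSL ℝ (ν σ l) :
        E →L[ℝ] ℝ) : E →ₗ[ℝ] ℝ) :=
      block_le
        (fun f => by
          simp [real_inner_comm (M σ f), hM.inner_map_noise])
        (fun j => by
          have := congrFun (congrFun h2 i) j
          simpa [Matrix.mul_apply, crossGram_apply] using this)
    simpa using this hf
  rw [hM.crossGram_state hξ hf, Matrix.mul_smul, Matrix.mul_add, ← Matrix.mul_assoc, h1,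
    ← Matrix.mul_assoc, Matrix.zero_mul, zero_add]
  convert smul_zero _
  ext i j
  simpa [Matrix.mul_apply, crossGram_apply] using key (f j) (hf j) i

/-- This turns operators into matrices: appending a letter to `f` multiplies its covariance with the
state by `√p_σ A_σ`. For inadmissible pairs both sides are zero, the right one by the transition
conditions. -/
theorem crossGram_state_map (hξ : IsState M ν pr A K ξ)
    (hT : ∀ σ τ, [σ, τ] ∉ L → A τ * A σ = 0 ∧ A τ * K σ * crossGram (ν σ) (ν σ) = 0)
    {σ τ : S} {f : Fin k → E} (hf : ∀ j, f j ∈ block M ν τ) :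
    crossGram ξ (M σ ∘ f) = (√(pr σ) • A σ) * crossGram ξ f := by
  rw [hM.crossGram_state hξ (f := M σ ∘ f) (fun j => map_mem_block σ (f j)), hM.crossGram_noise_map,
    Matrix.mul_zero, add_zero, Matrix.smul_mul]
  by_cases hL : [τ, σ] ∈ L
  · congr 2
    ext i j
    rw [crossGram_apply, crossGram_apply, real_inner_comm, Function.comp_apply,
      Function.comp_apply, hM.inner_map_block hL (hf j), real_inner_comm]
  · rw [hM.mul_crossGram_state_eq_zero hξ (hT τ σ hL).1 (hT τ σ hL).2 hf, smul_zero]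
    convert smul_zero _
    have : M σ ∘ f = 0 := by
      funext j; exact hM.map_block hL (hf j)
    rw [this]
    convert Matrix.mul_zero _
    ext i j; simp [crossGram_apply]

theorem crossGram_state_wordApply (hξ : IsState M ν pr A K ξ)
    (hT : ∀ σ τ, [σ, τ] ∉ L → A τ * A σ = 0 ∧ A τ * K σ * crossGram (ν σ) (ν σ) = 0)
    {σ : S} {f : Fin k → E} (hf : ∀ j, f j ∈ block M ν σ) (w : List S) :
    crossGram ξ (wordApply M w ∘ f)
      = wordProd (fun σ => √(pr σ) • A σ) w * crossGram ξ f := by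
  induction w using List.reverseRecOn with
  | nil => simp [wordProd]; rfl
  | append_singleton w τ ih =>
    have : wordApply M (w ++ [τ]) ∘ f = M τ ∘ (wordApply M w ∘ f) := by
      funext j; exact wordApply_append_singleton _ _ _
    rw [this, hM.crossGram_state_map hξ hT (f := wordApply M w ∘ f) (fun j => wordApply_mem_block (hf j) w), ih,
      wordProd_append]
    simp [wordProd, Matrix.mul_assoc]

open Classical in
-- Multiplied by `p_σ`, this is the Lyapunov-type equation (1) for the matrices `p_σ ⟨M_σ ξ, M_σ
-- ξ⟩`. The summands of `M_σ ξ` are orthogonal, and those with `τσ` inadmissible vanish.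
theorem crossGram_map_state (hpr : ∀ σ, 0 < pr σ) (hξ : IsState M ν pr A K ξ) (σ : S) :
    crossGram (M σ ∘ ξ) (M σ ∘ ξ) = ∑ τ ∈ Finset.univ.filter (fun τ => [τ, σ] ∈ L),
      (A τ * (pr τ • crossGram (M τ ∘ ξ) (M τ ∘ ξ)) * (A τ)ᵀ
        + K τ * (pr τ • crossGram (ν τ) (ν τ)) * (K τ)ᵀ) := by
  let b : S → Fin n → E := fun τ => matAct (A τ) (M τ ∘ ξ) + matAct (K τ) (ν τ)
  have hb : ∀ τ i, b τ i ∈ block M ν τ := fun τ i => matAct_add_matAct_mem_block _ _ _ _ _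
  have hbb : ∀ τ, crossGram (b τ) (b τ) = A τ * crossGram (M τ ∘ ξ) (M τ ∘ ξ) * (A τ)ᵀ
      + K τ * crossGram (ν τ) (ν τ) * (K τ)ᵀ := fun τ => by
    simp only [b, crossGram_add_right, crossGram_add_left, crossGram_matAct_right,
      crossGram_matAct_left, hM.crossGram_map_noise, hM.crossGram_noise_map, Matrix.mul_zero,
      add_zero, zero_add]
  have hMb : ∀ τ τ', crossGram (M σ ∘ b τ) (M σ ∘ b τ')
      = if τ = τ' ∧ [τ, σ] ∈ L then crossGram (b τ) (b τ') else 0 := by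
    intro τ τ'
    ext i j
    by_cases hL : [τ, σ] ∈ L
    · by_cases hτ : τ = τ'
      · rw [if_pos ⟨hτ, hL⟩]; exact hM.inner_map_block hL (hb τ i) _
      · rw [if_neg (by tauto)]
        exact (hM.inner_map_block hL (hb τ i) _).trans
          (hM.inner_block_block hτ (hb τ i) (hb τ' j))
    · rw [if_neg (by tauto), crossGram_apply, Function.comp_apply, hM.map_block hL (hb τ i)]
      simp
  have hξ' : M σ ∘ ξ = ∑ τ, √(pr τ) • (M σ ∘ b τ) := by
    conv_lhs => rw [hξ, map_comp_sum]
    exact Finset.sum_congr rfl fun τ _ => map_comp_smul _ _ _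
  conv_lhs => rw [hξ']
  simp only [crossGram_sum_left, crossGram_sum_right, crossGram_smul_left, crossGram_smul_right,
    hMb]
  rw [Finset.sum_filter]
  refine Finset.sum_congr rfl fun τ _ => ?_
  rw [Finset.sum_eq_single τ]
  · by_cases hL : [τ, σ] ∈ L
    · rw [if_pos ⟨rfl, hL⟩, if_pos hL, hbb, smul_smul, Real.mul_self_sqrt (hpr τ).le, smul_add,
        Matrix.mul_smul, Matrix.mul_smul, Matrix.smul_mul, Matrix.smul_mul]
    · rw [if_neg (by tauto), if_neg hL]; simp
  · intro τ' _ h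
    rw [if_neg (by tauto)]; simp
  · simp

/-- The scaled Gram matrices of `M_σ ξ` solve the homogeneous Lyapunov-type equation, so each `M_σ
ξ` is zero. -/
theorem state_eq_zero (hpr : ∀ σ, 0 < pr σ)
    (hA : IsStableMatrix (∑ σ, pr σ • ((A σ)ᵀ ⊗ₖ (A σ)ᵀ)))
    (hT : ∀ σ τ, [σ, τ] ∉ L → A τ * A σ = 0)
    (hξ : ξ = ∑ σ, √(pr σ) • matAct (A σ) (M σ ∘ ξ)) : ξ = 0 := by
  classical
  have hξ' : IsState M ν pr A 0 ξ := by
    rw [IsState]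
    conv_lhs => rw [hξ]
    refine Finset.sum_congr rfl fun σ _ => ?_
    congr 1
    funext i
    simp [matAct]
  have h0 : (fun σ => pr σ • crossGram (M σ ∘ ξ) (M σ ∘ ξ)) = 0 := by
    refine lyapunov_homogeneous_eq_zero hA hT fun σ => ?_
    conv_lhs => rw [hM.crossGram_map_state hpr hξ']
    simp
  have h1 : ∀ σ, M σ ∘ ξ = 0 := fun σ => eq_zero_of_crossGram_self <| by
    simpa [(hpr σ).ne'] using congrFun h0 σ
  rw [hξ]
  simp only [h1]
  funext i
  simp [matAct]

/-- The Kalman filter: `ξ'` is the projection of `ξ` onto the space of past outputs and `ε` is the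
innovation. The conclusions are what is needed for a regular system with state `ξ'` and noise `ε`,
together with the fact that `ξ'` satisfies every linear relation obeyed by the covariances of `ξ`
with past outputs. -/
theorem exists_innovation [CompleteSpace E] (hpr : ∀ σ, 0 < pr σ)
    (hA : IsStableMatrix (∑ σ, pr σ • ((A σ)ᵀ ⊗ₖ (A σ)ᵀ)))
    (hξ : IsState M ν pr A K ξ)
    (hT : ∀ σ τ, [σ, τ] ∉ L → A τ * A σ = 0 ∧ A τ * K σ * crossGram (ν σ) (ν σ) = 0)
    (C : Matrix (Fin p) (Fin n) ℝ) (D : Matrix (Fin p) (Fin m) ℝ) :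
    ∃ (ξ' : Fin n → E) (K' : S → Matrix (Fin n) (Fin p) ℝ) (ε : S → Fin p → E),
      (∀ σ, ε σ = matAct C (M σ ∘ (ξ - ξ')) + matAct D (ν σ)) ∧
      IsState M ε pr A K' ξ' ∧
      (∀ i, ξ' i ∈ cyc M ε) ∧
      (∀ σ w i j, inner ℝ ((ξ - ξ') i) (wordApply M w (ε σ j)) = 0) ∧
      (∀ σ τ w ρ i j, inner ℝ (ε σ i) (M τ (wordApply M w (ε ρ j))) = 0) ∧
      (∀ l : Fin n → ℝ,
        (∀ σ w, l ᵥ* crossGram ξ (wordApply M w ∘ (matAct C (M σ ∘ ξ) + matAct D (ν σ))) = 0) →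
        ∑ i, l i • ξ' i = 0) ∧
      (∀ σ τ, [σ, τ] ∉ L → A τ * K' σ * crossGram (ε σ) (ε σ) = 0) := by
  classical
  let η : S → Fin p → E := fun σ => matAct C (M σ ∘ ξ) + matAct D (ν σ)
  have hη : ∀ σ j, η σ j ∈ block M ν σ := fun σ j => matAct_add_matAct_mem_block _ _ _ _ _
  let Y := cyc M η
  have hYc : CompleteSpace Y := (isClosed_cyc (M := M) (ζ := η)).completeSpace_coe
  choose ξ' hξ'Y hξ'o using fun i =>
    Submodule.HasOrthogonalProjection.exists_orthogonal (K := Y) (ξ i)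
  replace hξ'o : ∀ i, ∀ g ∈ Y, inner ℝ ((ξ - ξ') i) g = 0 := fun i =>
    (Submodule.mem_orthogonal' _ _).1 (hξ'o i)
  let ε : S → Fin p → E := fun σ => matAct C (M σ ∘ (ξ - ξ')) + matAct D (ν σ)
  have hεη : ∀ σ, ε σ = η σ - matAct C (M σ ∘ ξ') := fun σ => by
    simp only [ε, η, map_comp_sub, matAct_sub]; abel
  have hε : ∀ σ j, ε σ j ∈ block M ν σ := fun σ j => matAct_add_matAct_mem_block _ _ _ _ _
  have hεY : ∀ σ j, ε σ j ∈ Y := fun σ j => by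
    rw [hεη]
    exact Y.sub_mem (mem_cyc σ j) (matAct_mem _ _ (fun i => map_mem_cyc σ (hξ'Y i)) j)
  -- past outputs, shifted, are orthogonal to the shifted estimation error and to the innovation
  have hdY : ∀ i σ τ, ∀ g ∈ Y, inner ℝ (M σ ((ξ - ξ') i)) (M τ g) = 0 := fun i σ τ g hg =>
    hM.inner_map_map_eq_zero hη
      (fun ρ w j => hξ'o i _ (wordApply_mem_cyc ρ w j)) σ τ hg
  have hνM : ∀ σ j τ g, inner ℝ (ν σ j) (M τ g) = 0 := fun σ j τ g => by
    rw [real_inner_comm]; exact hM.inner_map_noise τ σ g j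
  have hεMY : ∀ σ i τ, ∀ g ∈ Y, inner ℝ (ε σ i) (M τ g) = 0 := fun σ i τ g hg => by
    simp only [ε, Pi.add_apply, matAct, inner_add_left, sum_inner, real_inner_smul_left,
      Function.comp_apply, hdY _ σ τ g hg, hνM]
    simp
  -- The filter gain regresses the part of the next state not predicted from `ξ'` on the innovation
  -- with the same last letter.
  choose K' hK' using fun σ =>
    exists_matAct_orthogonal (matAct (A σ) (M σ ∘ (ξ - ξ')) + matAct (K σ) (ν σ)) (ε σ)
  -- the Kalman filter recursion
  have hstate : IsState M ε pr A K' ξ' := by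
    -- `θ` lies in `Y`, and `ξ - θ` will be orthogonal to `Y`; uniqueness of the projection then
    -- gives `θ = ξ'`.
    let θ : Fin n → E := ∑ σ, √(pr σ) • (matAct (A σ) (M σ ∘ ξ') + matAct (K' σ) (ε σ))
    have hθY : ∀ i, θ i ∈ Y := fun i => by
      simp only [θ, Finset.sum_apply, Pi.smul_apply, Pi.add_apply]
      exact Y.sum_mem fun σ _ => Y.smul_mem _ (Y.add_mem
        (matAct_mem _ _ (fun i => map_mem_cyc σ (hξ'Y i)) i) (matAct_mem _ _ (hεY σ) i))
    let d : S → Fin n → E := fun σ =>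
      (matAct (A σ) (M σ ∘ (ξ - ξ')) + matAct (K σ) (ν σ)) - matAct (K' σ) (ε σ)
    have hθd : ξ - θ = ∑ σ, √(pr σ) • d σ := by
      conv_lhs => rw [hξ]
      rw [← Finset.sum_sub_distrib]
      refine Finset.sum_congr rfl fun σ _ => ?_
      rw [← smul_sub]
      simp only [d, map_comp_sub, matAct_sub]
      congr 1
      abel
    have hdM : ∀ σ i τ, ∀ g ∈ Y, inner ℝ (d σ i) (M τ g) = 0 := fun σ i τ g hg => by
      have h1 : ∀ l, inner ℝ (M σ (ξ l - ξ' l)) (M τ g) = 0 := fun l => hdY l σ τ g hg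
      simp only [d, Pi.sub_apply, Pi.add_apply, matAct, inner_add_left, inner_sub_left, sum_inner,
        real_inner_smul_left, Function.comp_apply, h1, hνM, hεMY σ _ τ g hg]
      simp
    have hdε : ∀ σ i τ j, inner ℝ (d σ i) (ε τ j) = 0 := fun σ i τ j => by
      by_cases h : σ = τ
      · subst h; exact hK' σ i j
      · exact hM.inner_block_block h ((block M ν σ).sub_mem
          (matAct_add_matAct_mem_block _ _ _ _ _) (matAct_mem _ _ (hε σ) i)) (hε τ j)
    have hdη : ∀ σ i τ j, inner ℝ (d σ i) (η τ j) = 0 := fun σ i τ j => by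
      have : η τ j = ε τ j + ∑ l, C j l • M τ (ξ' l) := by
        rw [hεη]; simp [matAct]
      rw [this, inner_add_right, hdε, inner_sum]
      simp [real_inner_smul_right, hdM σ i τ _ (hξ'Y _)]
    have hdgen : ∀ σ i τ w j, inner ℝ (d σ i) (wordApply M w (η τ j)) = 0 := by
      intro σ i τ w j
      induction w using List.reverseRecOn with
      | nil => exact hdη σ i τ j
      | append_singleton w ρ _ =>
        rw [wordApply_append_singleton]; exact hdM σ i ρ _ (wordApply_mem_cyc τ w j)
    have hdY' : ∀ i, ∀ g ∈ Y, inner ℝ ((ξ - θ) i) g = 0 := fun i g hg => by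
      refine inner_eq_zero_of_mem_cyc (ContinuousLinearMap.id ℝ E) (fun τ w j => ?_) hg
      simp only [hθd, ContinuousLinearMap.id_apply, Finset.sum_apply, Pi.smul_apply, sum_inner,
        real_inner_smul_left, hdgen]
      simp
    funext i
    have h1 : ξ' i - θ i ∈ Y := Y.sub_mem (hξ'Y i) (hθY i)
    have h2 : inner ℝ (ξ' i - θ i) (ξ' i - θ i) = (0 : ℝ) := by
      have : ξ' i - θ i = (ξ - θ) i - (ξ - ξ') i := by simp
      nth_rewrite 1 [this]
      rw [inner_sub_left, hdY' i _ h1, hξ'o i _ h1, sub_zero]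
    exact sub_eq_zero.1 (inner_self_eq_zero.1 h2)
  have hcycY : cyc M ε ≤ Y := cyc_le isClosed_cyc fun σ w j => wordApply_mem_cyc_of_mem (hεY σ j) w
  -- the estimate only depends on the innovations: the remainder solves a noise-free equation
  have hmem : ∀ i, ξ' i ∈ cyc M ε := by
    have hZc : CompleteSpace (cyc M ε) := (isClosed_cyc (M := M) (ζ := ε)).completeSpace_coe
    choose ζ hζZ hζo using fun i =>
      Submodule.HasOrthogonalProjection.exists_orthogonal (K := cyc M ε) (ξ' i)
    replace hζo : ∀ i, ∀ g ∈ cyc M ε, inner ℝ ((ξ' - ζ) i) g = 0 := fun i =>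
      (Submodule.mem_orthogonal' _ _).1 (hζo i)
    let θ : Fin n → E := ∑ σ, √(pr σ) • (matAct (A σ) (M σ ∘ ζ) + matAct (K' σ) (ε σ))
    have hθZ : ∀ i, θ i ∈ cyc M ε := fun i => by
      simp only [θ, Finset.sum_apply, Pi.smul_apply, Pi.add_apply]
      exact Submodule.sum_mem _ fun σ _ => Submodule.smul_mem _ _ (Submodule.add_mem _
        (matAct_mem _ _ (fun i => map_mem_cyc σ (hζZ i)) i) (matAct_mem _ _ (mem_cyc σ) i))
    have hθd : ξ' - θ = ∑ σ, √(pr σ) • matAct (A σ) (M σ ∘ (ξ' - ζ)) := by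
      conv_lhs => rw [hstate]
      rw [← Finset.sum_sub_distrib]
      refine Finset.sum_congr rfl fun σ _ => ?_
      rw [← smul_sub]
      simp only [map_comp_sub, matAct_sub]
      congr 1
      abel
    have hgen : ∀ i σ τ w j, inner ℝ (M σ ((ξ' - ζ) i)) (wordApply M w (ε τ j)) = 0 := by
      intro i σ τ w j
      induction w using List.reverseRecOn with
      | nil =>
        rw [real_inner_comm]
        exact hεMY τ j σ _ (Y.sub_mem (hξ'Y i) (hcycY (hζZ i)))
      | append_singleton w ρ _ =>
        rw [wordApply_append_singleton]
        exact hM.inner_map_map_eq_zero hε (fun ρ w j => hζo i _ (wordApply_mem_cyc ρ w j)) σ ρ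
          (wordApply_mem_cyc τ w j)
    have hθo : ∀ i, ∀ g ∈ cyc M ε, inner ℝ ((ξ' - θ) i) g = 0 := fun i g hg => by
      refine inner_eq_zero_of_mem_cyc (ContinuousLinearMap.id ℝ E) (fun τ w j => ?_) hg
      have := fun l σ => hgen l σ τ w j
      simp only [hθd, ContinuousLinearMap.id_apply, Finset.sum_apply, Pi.smul_apply, matAct,
        sum_inner, real_inner_smul_left, Function.comp_apply, this]
      simp
    have hζθ : ζ = θ := by
      funext i
      have h1 : ζ i - θ i ∈ cyc M ε := Submodule.sub_mem _ (hζZ i) (hθZ i)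
      have h2 : inner ℝ (ζ i - θ i) (ζ i - θ i) = (0 : ℝ) := by
        have : ζ i - θ i = (ξ' - θ) i - (ξ' - ζ) i := by simp
        nth_rewrite 1 [this]
        rw [inner_sub_left, hθo i _ h1, hζo i _ h1, sub_zero]
      exact sub_eq_zero.1 (inner_self_eq_zero.1 h2)
    -- By the same uniqueness argument `ζ` obeys the filter equation with the same innovations, so
    -- the difference is a state without noise.
    have h0 : ξ' - ζ = 0 := by
      refine hM.state_eq_zero hpr hA (fun σ τ h => (hT σ τ h).1) ?_
      rw [← hθd, ← hζθ]
    intro i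
    have := congrFun h0 i
    rw [Pi.sub_apply, Pi.zero_apply, sub_eq_zero] at this
    rw [this]; exact hζZ i
  refine ⟨ξ', K', ε, fun σ => rfl, hstate, hmem,
    fun σ w i j => hξ'o i _ (wordApply_mem_cyc_of_mem (hεY σ j) w),
    fun σ τ w ρ i j => hεMY σ i τ _ (wordApply_mem_cyc_of_mem (hεY ρ j) w), ?_, ?_⟩
  · intro l hl
    -- `∑ l i • ξ' i` is the projection onto `Y` of `∑ l i • ξ i`, which is orthogonal to all
    -- generators of `Y`.
    have h1 : ∀ g ∈ Y, inner ℝ (∑ i, l i • ξ i) g = 0 := fun g hg => by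
      refine inner_eq_zero_of_mem_cyc (ContinuousLinearMap.id ℝ E) (fun τ w j => ?_) hg
      have := congrFun (hl τ w) j
      simpa [Matrix.vecMul, dotProduct, crossGram_apply, sum_inner, real_inner_smul_left, η] using this
    have h2 : ∀ g ∈ Y, inner ℝ (∑ i, l i • ξ' i) g = 0 := fun g hg => by
      have h3 : ∑ i, l i • ξ' i = ∑ i, l i • ξ i - ∑ i, l i • (ξ - ξ') i := by
        simp [← Finset.sum_sub_distrib, ← smul_sub]
      rw [h3, inner_sub_left, h1 g hg, sum_inner]
      simp only [real_inner_smul_left, hξ'o _ g hg]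
      simp
    exact inner_self_eq_zero.1 (h2 _ (Y.sum_mem fun i _ => Y.smul_mem _ (hξ'Y i)))
  · intro σ τ h
    -- Up to the factor `√p_σ`, `K' σ` times the innovation covariance is the covariance of the
    -- original state with `ε σ`, which `A τ` kills.
    have h1 : crossGram ξ (ε σ) = crossGram ξ' (ε σ) := by
      rw [← sub_eq_zero, ← crossGram_sub_left]
      ext i j; exact hξ'o i _ (hεY σ j)
    have h2 : crossGram ξ' (ε σ) = √(pr σ) • (K' σ * crossGram (ε σ) (ε σ)) := by
      conv_lhs => rw [hstate]
      rw [crossGram_sum_left, Finset.sum_eq_single σ]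
      · rw [crossGram_smul_left, crossGram_add_left, crossGram_matAct_left, crossGram_matAct_left]
        have : crossGram (M σ ∘ ξ') (ε σ) = 0 := by
          ext i j
          rw [crossGram_apply, real_inner_comm]
          exact hεMY σ j σ _ (hξ'Y i)
        rw [this, Matrix.mul_zero, zero_add]
      · intro ρ _ hρ
        rw [crossGram_smul_left]
        convert smul_zero _
        ext i j
        exact hM.inner_block_block hρ ((block M ν ρ).add_mem
          (matAct_mem _ _ (fun i => map_mem_block ρ (ξ' i)) i) (matAct_mem _ _ (hε ρ) i)) (hε σ j)
      · simp
    have h3 := hM.mul_crossGram_state_eq_zero hξ (hT σ τ h).1 (hT σ τ h).2 (hε σ)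
    rw [h1, h2, Matrix.mul_smul, ← Matrix.mul_assoc, smul_eq_zero] at h3
    exact h3.resolve_left (Real.sqrt_pos.2 (hpr σ)).ne'

end IsShiftSystem

end State

/-! ## Extension of densely defined maps -/

section Extension

variable {Z H F : Type*} [NormedAddCommGroup H] [InnerProductSpace ℝ H] [NormedAddCommGroup F]
  [InnerProductSpace ℝ F]

theorem inner_linearCombination_congr {a a' : Z → H} {b b' : Z → F}
    (h : ∀ i j, inner ℝ (a i) (a' j) = inner ℝ (b i) (b' j)) (c d : Z →₀ ℝ) :
    inner ℝ (Finsupp.linearCombination ℝ a c) (Finsupp.linearCombination ℝ a' d)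
      = inner ℝ (Finsupp.linearCombination ℝ b c) (Finsupp.linearCombination ℝ b' d) := by
  simp [Finsupp.linearCombination_apply, Finsupp.sum, sum_inner, inner_sum, real_inner_smul_left,
    real_inner_smul_right, h]

theorem denseRange_linearCombination {γ : Z → H}
    (hγ : (Submodule.span ℝ (Set.range γ)).topologicalClosure = ⊤) :
    DenseRange (Finsupp.linearCombination ℝ γ) := by
  intro x
  have : x ∈ (Submodule.span ℝ (Set.range γ)).topologicalClosure := by rw [hγ]; trivial
  rw [← Finsupp.range_linearCombination] at this
  exact this

theorem exists_extension [CompleteSpace F] {γ : Z → H}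
    (hγ : (Submodule.span ℝ (Set.range γ)).topologicalClosure = ⊤) (δ : Z → F)
    (h : ∀ c, ‖Finsupp.linearCombination ℝ δ c‖ ≤ ‖Finsupp.linearCombination ℝ γ c‖) :
    ∃ B : H →L[ℝ] F, ∀ i, B (γ i) = δ i := by
  refine ⟨(Finsupp.linearCombination ℝ δ).extendOfNorm (Finsupp.linearCombination ℝ γ),
    fun i => ?_⟩
  have := LinearMap.extendOfNorm_eq (f := Finsupp.linearCombination ℝ δ)
    (denseRange_linearCombination hγ) ⟨1, by simpa using h⟩ (Finsupp.single i 1)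
  simpa using this

theorem exists_isometric_extension [CompleteSpace F] {γ : Z → H}
    (hγ : (Submodule.span ℝ (Set.range γ)).topologicalClosure = ⊤) (δ : Z → F)
    (h : ∀ i j, inner ℝ (δ i) (δ j) = inner ℝ (γ i) (γ j)) :
    ∃ B : H →ₗᵢ[ℝ] F, ∀ i, B (γ i) = δ i := by
  have hn : ∀ c, ‖Finsupp.linearCombination ℝ δ c‖ = ‖Finsupp.linearCombination ℝ γ c‖ := by
    intro c
    rw [← sq_eq_sq₀ (norm_nonneg _) (norm_nonneg _), ← real_inner_self_eq_norm_sq,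
      ← real_inner_self_eq_norm_sq, inner_linearCombination_congr h]
  obtain ⟨B, hB⟩ := exists_extension hγ δ fun c => (hn c).le
  have hB' : ∀ c, B (Finsupp.linearCombination ℝ γ c) = Finsupp.linearCombination ℝ δ c := by
    intro c
    simp [Finsupp.linearCombination_apply, Finsupp.sum, hB]
  refine ⟨⟨B, fun x => ?_⟩, hB⟩
  refine (denseRange_linearCombination hγ).induction_on (p := fun x => ‖B x‖ = ‖x‖) x
    (isClosed_eq (by fun_prop) continuous_norm) fun c => ?_
  rw [hB', hn]

theorem map_eq_zero_of_dense {γ : Z → H}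
    (hγ : (Submodule.span ℝ (Set.range γ)).topologicalClosure = ⊤) (B : H →L[ℝ] F)
    (h : ∀ i, B (γ i) = 0) (x : H) : B x = 0 := by
  have h1 : (Submodule.span ℝ (Set.range γ)).topologicalClosure
      ≤ LinearMap.ker (B : H →ₗ[ℝ] F) := by
    refine Submodule.topologicalClosure_minimal _ (Submodule.span_le.2 ?_) B.isClosed_ker
    rintro _ ⟨i, rfl⟩; exact h i
  rw [hγ] at h1
  exact h1 trivial

end Extension

/-! ## Words, inputs and the processes `z` -/

section Inputs

variable {Ω S : Type*} [MeasurableSpace Ω] {μ : Measure Ω} {u : S → ℤ → Ω → ℝ} {pr : S → ℝ}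
  {L : Set (List S)}

omit [MeasurableSpace Ω] in
theorem inputProd_append_singleton (w : List S) (σ : S) (t : ℤ) (ω : Ω) :
    inputProd u (w ++ [σ]) t ω = inputProd u w (t - 1) ω * u σ t ω := by
  -- Indexing with `getD` frees the product from indices in `Fin w.length`; the default letter is
  -- never read.
  have key : ∀ (v : List S) (s : ℤ), inputProd u v s ω
      = ∏ i ∈ Finset.range v.length, u (v.getD i σ) (s - v.length + 1 + (i : ℕ)) ω := by
    intro v s
    rw [inputProd, Finset.prod_range]
    simp
  rw [key, key, List.length_append, List.length_singleton, Finset.prod_range_succ]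
  congr 1
  · refine Finset.prod_congr rfl fun i hi => ?_
    rw [List.getD_append _ _ _ _ (Finset.mem_range.1 hi)]
    congr 1
    push_cast; ring
  · rw [List.getD_append_right _ _ _ _ le_rfl]
    have : t - (w.length + 1 : ℤ) + 1 + w.length = t := by ring
    simp [this]

theorem wordWeight_pos (hpr : ∀ σ, 0 < pr σ) (w : List S) : 0 < wordWeight pr w :=
  List.prod_pos fun a ha => by
    obtain ⟨σ, _, rfl⟩ := List.mem_map.1 ha
    exact hpr σ

omit [MeasurableSpace Ω] in
theorem zproc_nil {k : ℕ} (r : ℤ → Ω → Fin k → ℝ) (t : ℤ) : zproc u pr r [] t = r t := by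
  funext ω
  simp [zproc, inputProd, wordWeight]

omit [MeasurableSpace Ω] in
theorem zproc_append_singleton (hpr : ∀ σ, 0 < pr σ) {k : ℕ} (r : ℤ → Ω → Fin k → ℝ) (w : List S)
    (σ : S) (t : ℤ) (ω : Ω) :
    zproc u pr r (w ++ [σ]) (t + 1) ω = (u σ t ω / √(pr σ)) • zproc u pr r w t ω := by
  have h1 : wordWeight pr (w ++ [σ]) = wordWeight pr w * pr σ := by simp [wordWeight]
  have h2 : t + 1 - ((w ++ [σ]).length : ℤ) = t - w.length := by
    simp
  rw [zproc, zproc, h1, h2, Real.sqrt_mul (wordWeight_pos hpr w).le, add_sub_cancel_right,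
    inputProd_append_singleton, smul_smul]
  congr 1
  ring

omit [MeasurableSpace Ω] in
theorem zproc_singleton (hpr : ∀ σ, 0 < pr σ) {k : ℕ} (r : ℤ → Ω → Fin k → ℝ) (σ : S) (t : ℤ)
    (ω : Ω) : zproc u pr r [σ] (t + 1) ω = (u σ t ω / √(pr σ)) • r t ω := by
  have := zproc_append_singleton (u := u) hpr r [] σ t ω
  rwa [zproc_nil] at this

namespace IsAdmissible

variable (hL : IsAdmissible μ u L)

include hL

theorem append_pair_notMem {τ σ : S} (h : [τ, σ] ∉ L) (w : List S) : w ++ [τ] ++ [σ] ∉ L := by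
  obtain ⟨E, hE⟩ := hL.transitions
  rw [hE _ (by simp)] at h ⊢
  simp only [List.append_assoc, List.isChain_append] at h ⊢
  intro h'
  exact h (by simpa using h'.2.1)

theorem append_pair_mem_iff {τ σ : S} (h : [τ, σ] ∈ L) (w : List S) :
    w ++ [τ] ++ [σ] ∈ L ↔ w ++ [τ] ∈ L := by
  rcases w.eq_nil_or_concat with rfl | ⟨w, ρ, rfl⟩
  · simpa [h] using hL.letters τ
  obtain ⟨E, hE⟩ := hL.transitions
  rw [hE _ (by simp)] at h
  rw [hE _ (by simp), hE _ (by simp), List.isChain_append (l₂ := [σ])]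
  simp at h
  simp [h]

/-- Since `∑ α_σ u_σ = 1`, `u_w(t)` is a combination of the products `u_{wσ}(t+1)`, all of which
vanish. -/
theorem inputProd_ae_zero [Fintype S] (hu : InputAssumption μ u) {w : List S}
    (h : ∀ σ, w ++ [σ] ∉ L) (t : ℤ) : inputProd u w t =ᵐ[μ] 0 := by
  obtain ⟨α, hα⟩ := hu.affine
  have h1 : ∀ᵐ ω ∂μ, ∀ σ, inputProd u (w ++ [σ]) (t + 1) ω = 0 :=
    ae_all_iff.2 fun σ => hL.vanish _ (by simp) (h σ) (t + 1)
  filter_upwards [h1, hα (t + 1)] with ω h1 h2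
  have : ∑ σ, α σ * inputProd u (w ++ [σ]) (t + 1) ω = inputProd u w t ω := by
    simp only [inputProd_append_singleton, add_sub_cancel_right]
    conv_rhs => rw [← mul_one (inputProd u w t ω), ← h2, Finset.mul_sum]
    exact Finset.sum_congr rfl fun σ _ => by ring
  rw [← this]
  simp [h1]

end IsAdmissible

theorem zproc_ae_zero {w : List S} {t : ℤ} (h : inputProd u w (t - 1) =ᵐ[μ] 0) {k : ℕ}
    (r : ℤ → Ω → Fin k → ℝ) : ∀ᵐ ω ∂μ, zproc u pr r w t ω = 0 := by
  filter_upwards [h] with ω h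
  simp [zproc, h]

/-- The factor `c` may be unbounded, so continuity of multiplication is not available; its graph is
closed, by passing to almost surely convergent subsequences. -/
theorem ae_eq_mul_of_tendsto {c : Ω → ℝ} {a b : ℕ → Lp ℝ 2 μ} {a' b' : Lp ℝ 2 μ}
    (ha : Filter.Tendsto a Filter.atTop (nhds a')) (hb : Filter.Tendsto b Filter.atTop (nhds b'))
    (h : ∀ n, (b n : Ω → ℝ) =ᵐ[μ] fun ω => c ω * a n ω) :
    (b' : Ω → ℝ) =ᵐ[μ] fun ω => c ω * a' ω := by
  obtain ⟨φ, hφ, hφa⟩ := (tendstoInMeasure_of_tendsto_Lp ha).exists_seq_tendsto_ae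
  obtain ⟨ψ, hψ, hψb⟩ := (tendstoInMeasure_of_tendsto_Lp
    (hb.comp hφ.tendsto_atTop)).exists_seq_tendsto_ae
  filter_upwards [hφa, hψb, ae_all_iff.2 h] with ω h1 h2 h3
  refine tendsto_nhds_unique h2 ?_
  simp only [Function.comp_apply, h3]
  exact (h1.comp hψ.tendsto_atTop).const_mul _

theorem ae_eq_mul_of_dense {Z H : Type*} [NormedAddCommGroup H] [InnerProductSpace ℝ H]
    {γ : Z → H} (hγ : (Submodule.span ℝ (Set.range γ)).topologicalClosure = ⊤)
    (B B' : H →L[ℝ] Lp ℝ 2 μ) {c : Ω → ℝ}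
    (h : ∀ i, (B' (γ i) : Ω → ℝ) =ᵐ[μ] fun ω => c ω * B (γ i) ω) (x : H) :
    (B' x : Ω → ℝ) =ᵐ[μ] fun ω => c ω * B x ω := by
  let K : Submodule ℝ H :=
    { carrier := {x | (B' x : Ω → ℝ) =ᵐ[μ] fun ω => c ω * B x ω}
      add_mem' := fun {x y} hx hy => by
        simp only [Set.mem_ofPred_eq, map_add] at hx hy ⊢
        filter_upwards [hx, hy, Lp.coeFn_add (B x) (B y), Lp.coeFn_add (B' x) (B' y)]
          with ω h1 h2 h3 h4
        rw [h3, h4, Pi.add_apply, Pi.add_apply, h1, h2, mul_add]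
      zero_mem' := by
        simp only [Set.mem_ofPred_eq, map_zero]
        filter_upwards [Lp.coeFn_zero ℝ 2 μ] with ω h1
        rw [h1]; simp
      smul_mem' := fun r x hx => by
        simp only [Set.mem_ofPred_eq, map_smul] at hx ⊢
        filter_upwards [hx, Lp.coeFn_smul r (B x), Lp.coeFn_smul r (B' x)] with ω h1 h3 h4
        rw [h3, h4, Pi.smul_apply, Pi.smul_apply, h1, smul_eq_mul, smul_eq_mul]
        ring }
  have hK : IsClosed (K : Set H) := by
    refine IsSeqClosed.isClosed fun x y hx hxy => ?_
    exact ae_eq_mul_of_tendsto ((B.continuous.tendsto y).comp hxy)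
      ((B'.continuous.tendsto y).comp hxy) hx
  have h1 : (Submodule.span ℝ (Set.range γ)).topologicalClosure ≤ K := by
    refine Submodule.topologicalClosure_minimal _ (Submodule.span_le.2 ?_) hK
    rintro _ ⟨i, rfl⟩; exact h i
  rw [hγ] at h1
  exact h1 trivial

end Inputs

/-! ## The shift system of a white noise process -/

/-- The pasts of the noise `v` at all times, identified with one shift system. -/
structure NoiseModel {Ω S : Type*} [MeasurableSpace Ω] (μ : Measure Ω) (u : S → ℤ → Ω → ℝ)
    (pr : S → ℝ) (L : Set (List S)) {m : ℕ} (v : ℤ → Ω → Fin m → ℝ) where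
  /-- the past of the noise -/
  space : Submodule ℝ (Lp ℝ 2 μ)
  complete : CompleteSpace space
  /-- multiplication by the normalized inputs -/
  M : S → space →L[ℝ] space
  /-- the last values of the noise, multiplied by the normalized inputs -/
  ν : S → Fin m → space
  /-- the embedding as the past at time `t` -/
  ι : ℤ → space →ₗᵢ[ℝ] Lp ℝ 2 μ
  shift : IsShiftSystem L M ν
  dense : cyc M ν = ⊤
  ι_map : ∀ t σ f, (ι (t + 1) (M σ f) : Ω → ℝ) =ᵐ[μ] fun ω => u σ t ω / √(pr σ) * ι t f ω
  ι_noise : ∀ t σ j, (ι (t + 1) (ν σ j) : Ω → ℝ) =ᵐ[μ] fun ω => u σ t ω / √(pr σ) * v t ω j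
  integral_noise_mul : ∀ t j f, ∫ ω, v t ω j * ι t f ω ∂μ = 0
  integral_ι : ∀ t f, ∫ ω, ι t f ω ∂μ = 0

theorem integral_mul_eq_inner {Ω : Type*} [MeasurableSpace Ω] {μ : Measure Ω} {f g : Ω → ℝ}
    {F G : Lp ℝ 2 μ} (hf : (F : Ω → ℝ) =ᵐ[μ] f) (hg : (G : Ω → ℝ) =ᵐ[μ] g) :
    ∫ ω, f ω * g ω ∂μ = inner ℝ F G := by
  rw [L2.inner_def]
  refine integral_congr_ae ?_
  filter_upwards [hf, hg] with ω h1 h2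
  rw [h1, h2]
  simp [mul_comm]

variable {Ω S : Type*} [MeasurableSpace Ω] [Fintype S] {μ : Measure Ω}
  {u : S → ℤ → Ω → ℝ} {pr : S → ℝ} {L : Set (List S)} {m : ℕ} {v : ℤ → Ω → Fin m → ℝ}

/-- If `wσ` is admissible for some `σ`, the recursive covariance property makes `Λ_w` the transpose
of `T_{wσ,σ}`, which is zero for orthogonal noise; otherwise `u_w` itself vanishes. -/
theorem Lcov_noise_eq_zero (hu : InputAssumption μ u) (hL : IsAdmissible μ u L)
    (hv : IsRC μ u pr L v)
    (ho : ∀ w v' : List S, w ≠ [] → v' ≠ [] → w ≠ v' → ∀ t, Tcov μ u pr v w v' t = 0)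
    {w : List S} (hw : w ≠ []) (t : ℤ) : Lcov μ u pr v w t = 0 := by
  by_cases h : ∃ σ, w ++ [σ] ∈ L
  · obtain ⟨σ, h⟩ := h
    have h1 := hv.letter_same w hw σ h t
    rw [ho _ _ (by simp) (by simp) (by simpa using hw)] at h1
    rw [← Matrix.transpose_transpose (Lcov μ u pr v w t), ← h1, Matrix.transpose_zero]
  · push Not at h
    ext i j
    rw [Lcov, crossCov, Matrix.of_apply, Matrix.zero_apply, integral_eq_zero_of_ae]
    filter_upwards [zproc_ae_zero (pr := pr) (hL.inputProd_ae_zero hu h (t - 1)) v] with ω hω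
    simp [hω]

/-- The model is the past at time 0. Equality of Gram matrices at all times gives the isometric
embeddings `ι t`, and `M σ` extends `z_w ↦ z_{wσ}` by density. -/
theorem nonempty_noiseModel [IsProbabilityMeasure μ] (hu : InputAssumption μ u)
    (hpr : ∀ σ, 0 < pr σ) (hL : IsAdmissible μ u L) (hv : IsRC μ u pr L v)
    (ho : ∀ w v' : List S, w ≠ [] → v' ≠ [] → w ≠ v' → ∀ t, Tcov μ u pr v w v' t = 0) :
    Nonempty (NoiseModel μ u pr L v) := by
  classical
  let Z := {w : List S // w ≠ []} × Fin m
  let γ : ℤ → Z → Lp ℝ 2 μ := fun t i => (hv.memLp_z i.1.1 i.1.2 t i.2).toLp _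
  have hγ : ∀ t i, (γ t i : Ω → ℝ) =ᵐ[μ] fun ω => zproc u pr v i.1.1 t ω i.2 :=
    fun t i => MemLp.coeFn_toLp _
  have hin : ∀ t i j, inner ℝ (γ t i) (γ t j) = Tcov μ u pr v i.1.1 j.1.1 t i.2 j.2 :=
    fun t i j => (integral_mul_eq_inner (hγ t i) (hγ t j)).symm
  have hstat : ∀ t i j, inner ℝ (γ t i) (γ t j) = inner ℝ (γ 0 i) (γ 0 j) := fun t i j => by
    have := hv.stat_T i.1.1 j.1.1 i.1.2 j.1.2 0 t
    rw [zero_add] at this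
    rw [hin, hin, this]
  let W : Submodule ℝ (Lp ℝ 2 μ) := (Submodule.span ℝ (Set.range (γ 0))).topologicalClosure
  have hWc : CompleteSpace W := (Submodule.isClosed_topologicalClosure _).completeSpace_coe
  let γ' : Z → W := fun i => ⟨γ 0 i, Submodule.le_topologicalClosure _
    (Submodule.subset_span ⟨i, rfl⟩)⟩
  have hin' : ∀ i j, inner ℝ (γ' i) (γ' j) = Tcov μ u pr v i.1.1 j.1.1 0 i.2 j.2 := hin 0
  have hdense : (Submodule.span ℝ (Set.range γ')).topologicalClosure = ⊤ := by
    rw [eq_top_iff]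
    rintro x -
    have h1 : ((W.subtype '' (Submodule.span ℝ (Set.range γ') : Set W)))
        = (Submodule.span ℝ (Set.range (γ 0)) : Set (Lp ℝ 2 μ)) := by
      rw [← Submodule.map_coe, Submodule.map_span, ← Set.range_comp]
      rfl
    have h2 : x ∈ closure (Submodule.span ℝ (Set.range γ') : Set W) := by
      rw [closure_subtype]
      have h3 : (x : Lp ℝ 2 μ) ∈ closure (Submodule.span ℝ (Set.range (γ 0)) : Set (Lp ℝ 2 μ)) :=
        x.2
      rwa [← h1] at h3
    exact h2
  have hind : ∀ B : W →L[ℝ] ℝ, (∀ i, B (γ' i) = 0) → ∀ f, B f = 0 :=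
    fun B h f => map_eq_zero_of_dense hdense B h f
  -- the embeddings
  choose ι hι using fun t => exists_isometric_extension hdense (γ t) fun i j => hstat t i j
  -- the shifts
  let app : Z → S → Z := fun i σ => (⟨i.1.1 ++ [σ], by simp⟩, i.2)
  -- The expected value of `M_σ* M_σ` on generators: the orthogonal projection onto the words that
  -- can be followed by `σ`.
  let g : S → Z → W := fun σ i => if i.1.1 ++ [σ] ∈ L then γ' i else 0
  have hvan : ∀ i j : Z, (i.1.1 ∉ L ∨ j.1.1 ∉ L) → inner ℝ (γ' i) (γ' j) = 0 := fun i j h => by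
    rw [hin', hv.vanish _ _ i.1.2 j.1.2 h, Matrix.zero_apply]
  have hsame : ∀ (i j : Z) (σ : S), (i.1.1 ++ [σ] ∈ L ∨ j.1.1 ++ [σ] ∈ L) →
      inner ℝ (γ' (app i σ)) (γ' (app j σ)) = inner ℝ (γ' i) (γ' j) := fun i j σ h => by
    rw [hin', hin']
    exact congrFun (congrFun (hv.shift_same _ _ i.1.2 j.1.2 σ h 0) i.2) j.2
  have hg1 : ∀ σ i j, inner ℝ (γ' (app i σ)) (γ' (app j σ)) = inner ℝ (g σ i) (γ' j) := by
    intro σ i j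
    by_cases hi : i.1.1 ++ [σ] ∈ L
    · simp only [g, if_pos hi]; exact hsame i j σ (Or.inl hi)
    · simp only [g, if_neg hi, inner_zero_left]; exact hvan _ _ (Or.inl hi)
  have hg2 : ∀ σ i j, inner ℝ (g σ i) (γ' j) = inner ℝ (g σ i) (g σ j) := by
    intro σ i j
    by_cases hi : i.1.1 ++ [σ] ∈ L
    · by_cases hj : j.1.1 ++ [σ] ∈ L
      · simp only [g, if_pos hi, if_pos hj]
      · simp only [g, if_pos hi, if_neg hj, inner_zero_right]
        rw [hin', hv.vanish_right _ _ j.1.2 i.1.2 σ hi hj, Matrix.zero_apply]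
    · simp only [g, if_neg hi, inner_zero_left]
  -- If `a`, `b`, `d` denote the images of `c` under `γ'`, `g σ` and the shifted family, then `‖d‖²
  -- = ⟨b, a⟩ = ‖b‖²`; Cauchy–Schwarz gives `‖b‖ ≤ ‖a‖`, hence `‖d‖ ≤ ‖a‖`.
  have hle : ∀ σ c, ‖Finsupp.linearCombination ℝ (fun i => γ' (app i σ)) c‖
      ≤ ‖Finsupp.linearCombination ℝ γ' c‖ := by
    intro σ c
    have e1 := inner_linearCombination_congr (hg1 σ) c c
    have e2 := inner_linearCombination_congr (hg2 σ) c c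
    have e3 := real_inner_le_norm (Finsupp.linearCombination ℝ (g σ) c)
      (Finsupp.linearCombination ℝ γ' c)
    rw [real_inner_self_eq_norm_sq] at e1 e2
    have n1 := norm_nonneg (Finsupp.linearCombination ℝ (g σ) c)
    have n2 := norm_nonneg (Finsupp.linearCombination ℝ γ' c)
    have n3 : ‖Finsupp.linearCombination ℝ (g σ) c‖ ≤ ‖Finsupp.linearCombination ℝ γ' c‖ := by
      by_contra! hlt
      nlinarith
    refine le_trans (le_of_eq ?_) n3
    rw [← sq_eq_sq₀ (norm_nonneg _) n1, e1, e2]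
  choose M hM using fun σ => exists_extension hdense (fun i => γ' (app i σ)) (hle σ)
  let ν : S → Fin m → W := fun σ j => γ' (⟨[σ], by simp⟩, j)
  have hz : ∀ i j : Z, i.1.1 ≠ j.1.1 → inner ℝ (γ' i) (γ' j) = 0 := fun i j h => by
    rw [hin', ho _ _ i.1.2 j.1.2 h, Matrix.zero_apply]
  have hself : ∀ i : Z, i.1.1 ∉ L → γ' i = 0 := fun i h =>
    inner_self_eq_zero.1 (hvan i i (Or.inl h))
  have hshift : IsShiftSystem L M ν := by
    refine ⟨fun σ τ h f f' => ?_, fun σ τ f j => ?_, fun σ τ h i j => ?_, fun τ σ h f => ?_,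
      fun τ σ h j => ?_, fun τ σ h f f' => ?_, fun τ σ h j f => ?_⟩
    · have h1 : ∀ i f', inner ℝ (M σ (γ' i)) (M τ f') = 0 := fun i f' => by
        refine hind ((innerSL ℝ (M σ (γ' i))).comp (M τ)) (fun j => ?_) f'
        simp only [ContinuousLinearMap.comp_apply, innerSL_apply_apply, hM]
        refine hz _ _ fun h' => h ?_
        simpa using (List.append_inj' h' rfl).2
      have := hind ((innerSL ℝ (M τ f')).comp (M σ)) (fun i => by
        simp only [ContinuousLinearMap.comp_apply, innerSL_apply_apply]
        rw [real_inner_comm]; exact h1 i f') f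
      simp only [ContinuousLinearMap.comp_apply, innerSL_apply_apply] at this
      rwa [real_inner_comm] at this
    · have := hind ((innerSL ℝ (ν τ j)).comp (M σ)) (fun i => by
        simp only [ContinuousLinearMap.comp_apply, innerSL_apply_apply, hM]
        exact hz _ _ fun h' => i.1.2 (by simpa [app] using congrArg List.length h')) f
      simp only [ContinuousLinearMap.comp_apply, innerSL_apply_apply] at this
      rwa [real_inner_comm] at this
    · exact hz _ _ (by simpa using h)
    · refine map_eq_zero_of_dense hdense ((M σ).comp (M τ)) (fun i => ?_) f
      rw [ContinuousLinearMap.comp_apply, hM, hM]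
      exact hself _ (hL.append_pair_notMem h _)
    · simp only [ν, hM]
      exact hself _ (by simpa [app] using h)
    · have h1 : ∀ i f', inner ℝ (M σ (M τ (γ' i))) (M σ f') = inner ℝ (M τ (γ' i)) f' :=
        fun i f' => by
          have := hind ((innerSL ℝ (M σ (M τ (γ' i)))).comp (M σ) - innerSL ℝ (M τ (γ' i)))
            (fun j => by
              simp only [ContinuousLinearMap.comp_apply, innerSL_apply_apply, sub_apply, hM,
                sub_eq_zero]
              by_cases hi : i.1.1 ++ [τ] ++ [σ] ∈ L
              · exact hsame _ _ σ (Or.inl hi)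
              · rw [hvan _ _ (Or.inl hi), hvan _ _ (Or.inl
                  (fun h' => hi ((hL.append_pair_mem_iff h _).2 h')))]) f'
          simpa only [ContinuousLinearMap.comp_apply, innerSL_apply_apply, sub_apply,
            sub_eq_zero] using this
      have := hind ((innerSL ℝ (M σ f')).comp ((M σ).comp (M τ)) - (innerSL ℝ f').comp (M τ))
        (fun i => by
          simp only [ContinuousLinearMap.comp_apply, innerSL_apply_apply, sub_apply, sub_eq_zero]
          rw [real_inner_comm, h1, real_inner_comm]) f
      simp only [ContinuousLinearMap.comp_apply, innerSL_apply_apply, sub_apply,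
        sub_eq_zero] at this
      rw [real_inner_comm, this, real_inner_comm]
    · have := hind ((innerSL ℝ (M σ (ν τ j))).comp (M σ) - innerSL ℝ (ν τ j))
        (fun i => by
          simp only [ν, ContinuousLinearMap.comp_apply, innerSL_apply_apply, sub_apply, hM,
            sub_eq_zero]
          exact hsame _ _ σ (Or.inl h)) f
      simpa only [ContinuousLinearMap.comp_apply, innerSL_apply_apply, sub_apply,
        sub_eq_zero] using this
  have hcyc : cyc M ν = ⊤ := by
    rw [eq_top_iff, ← hdense]
    refine Submodule.topologicalClosure_minimal _ (Submodule.span_le.2 ?_) isClosed_cyc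
    rintro _ ⟨⟨⟨w, hw⟩, j⟩, rfl⟩
    induction w using List.reverseRecOn with
    | nil => exact absurd rfl hw
    | append_singleton w σ ih =>
      by_cases hw' : w = []
      · subst hw'; exact mem_cyc (M := M) (ζ := ν) σ j
      · have := map_mem_cyc σ (ih hw')
        rwa [hM] at this
  have hnoise : ∀ t σ j, (γ (t + 1) (⟨[σ], by simp⟩, j) : Ω → ℝ)
      =ᵐ[μ] fun ω => u σ t ω / √(pr σ) * v t ω j := fun t σ j => by
    filter_upwards [hγ (t + 1) (⟨[σ], by simp⟩, j)] with ω hω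
    rw [hω, zproc_singleton hpr]
    rfl
  refine ⟨⟨W, hWc, M, ν, ι, hshift, hcyc, fun t σ f => ?_, fun t σ j => ?_, fun t j f => ?_,
    fun t f => ?_⟩⟩
  · refine ae_eq_mul_of_dense hdense (ι t).toContinuousLinearMap
      ((ι (t + 1)).toContinuousLinearMap.comp (M σ)) (fun i => ?_) f
    simp only [ContinuousLinearMap.comp_apply, LinearIsometry.coe_toContinuousLinearMap, hM, hι]
    filter_upwards [hγ t i, hγ (t + 1) (app i σ)] with ω h1 h2
    rw [h1, h2, zproc_append_singleton hpr]
    rfl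
  · simp only [ν, hι]; exact hnoise t σ j
  · let V : Lp ℝ 2 μ := (hv.memLp t j).toLp _
    have hV : (V : Ω → ℝ) =ᵐ[μ] fun ω => v t ω j := MemLp.coeFn_toLp _
    rw [integral_mul_eq_inner hV (Filter.EventuallyEq.refl _ _)]
    refine hind ((innerSL ℝ V).comp (ι t).toContinuousLinearMap) (fun i => ?_) f
    simp only [ContinuousLinearMap.comp_apply, LinearIsometry.coe_toContinuousLinearMap, hι,
      innerSL_apply_apply]
    rw [← integral_mul_eq_inner hV (hγ t i)]
    exact congrFun (congrFun (Lcov_noise_eq_zero hu hL hv ho i.1.2 t) j) i.2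
  · let V : Lp ℝ 2 μ := (memLp_const (1 : ℝ)).toLp _
    have hV : (V : Ω → ℝ) =ᵐ[μ] fun _ => 1 := MemLp.coeFn_toLp _
    have h1 : ∀ F : Lp ℝ 2 μ, ∫ ω, F ω ∂μ = inner ℝ V F := fun F => by
      rw [← integral_mul_eq_inner hV (Filter.EventuallyEq.refl _ _)]
      simp
    rw [h1]
    refine hind ((innerSL ℝ V).comp (ι t).toContinuousLinearMap) (fun i => ?_) f
    simp only [ContinuousLinearMap.comp_apply, LinearIsometry.coe_toContinuousLinearMap, hι,
      innerSL_apply_apply]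
    rw [← h1, integral_congr_ae (hγ t i)]
    exact hv.mean_z _ i.1.2 t i.2

/-! ## Processes and their representatives in the shift system -/

section Tracking

variable {Ω S : Type*} [MeasurableSpace Ω] {μ : Measure Ω}
  {u : S → ℤ → Ω → ℝ} {pr : S → ℝ} {L : Set (List S)} {m k : ℕ} {v : ℤ → Ω → Fin m → ℝ}

theorem coeFn_sum_smul {ι : Type*} (s : Finset ι) (c : ι → ℝ) {F : ι → Lp ℝ 2 μ} {f : ι → Ω → ℝ}
    (h : ∀ i, (F i : Ω → ℝ) =ᵐ[μ] f i) :
    ((∑ i ∈ s, c i • F i : Lp ℝ 2 μ) : Ω → ℝ) =ᵐ[μ] fun ω => ∑ i ∈ s, c i * f i ω := by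
  classical
  induction s using Finset.induction_on with
  | empty =>
    filter_upwards [Lp.coeFn_zero ℝ 2 μ] with ω h1
    rw [Finset.sum_empty, h1]; simp
  | insert i s hi ih =>
    rw [Finset.sum_insert hi]
    filter_upwards [ih, h i, Lp.coeFn_add (c i • F i) (∑ i ∈ s, c i • F i),
      Lp.coeFn_smul (c i) (F i)] with ω h1 h2 h3 h4
    rw [Finset.sum_insert hi, h3, Pi.add_apply, h1, h4, Pi.smul_apply, h2, smul_eq_mul]

theorem sqrt_mul_div_sqrt_mul (hpr : ∀ σ, 0 < pr σ) (σ : S) (a b : ℝ) :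
    √(pr σ) * (a / √(pr σ) * b) = a * b := by
  have := (Real.sqrt_pos.2 (hpr σ)).ne'
  field_simp

namespace NoiseModel

variable (N : NoiseModel μ u pr L v)

/-- `ρ_σ` represents the process `r(t) u_σ(t) / √p_σ` at time `t + 1`. -/
def Tracks (r : ℤ → Ω → Fin k → ℝ) (ρ : S → Fin k → N.space) : Prop :=
  ∀ t σ j, (N.ι (t + 1) (ρ σ j) : Ω → ℝ) =ᵐ[μ] fun ω => u σ t ω / √(pr σ) * r t ω j

variable {N}

theorem Tracks.zproc_ae_eq (hpr : ∀ σ, 0 < pr σ) {r : ℤ → Ω → Fin k → ℝ}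
    {ρ : S → Fin k → N.space} (h : N.Tracks r ρ) (t : ℤ) (σ : S) (w : List S) (j : Fin k) :
    (N.ι t (wordApply N.M w (ρ σ j)) : Ω → ℝ) =ᵐ[μ] fun ω => zproc u pr r (σ :: w) t ω j := by
  induction w using List.reverseRecOn generalizing t with
  | nil =>
    obtain ⟨t, rfl⟩ : ∃ s, t = s + 1 := ⟨t - 1, by ring⟩
    filter_upwards [h t σ j] with ω hω
    rw [zproc_singleton hpr]
    exact hω
  | append_singleton w τ ih =>
    obtain ⟨t, rfl⟩ : ∃ s, t = s + 1 := ⟨t - 1, by ring⟩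
    rw [wordApply_append_singleton]
    filter_upwards [ih t, N.ι_map t τ (wordApply N.M w (ρ σ j))] with ω h1 h2
    rw [h2, h1, ← List.cons_append, zproc_append_singleton hpr]
    rfl

theorem Tracks.Tcov_eq (hpr : ∀ σ, 0 < pr σ) {r : ℤ → Ω → Fin k → ℝ}
    {ρ : S → Fin k → N.space} (h : N.Tracks r ρ) (t : ℤ) (σ σ' : S) (w w' : List S) :
    Tcov μ u pr r (σ :: w) (σ' :: w') t
      = crossGram (wordApply N.M w ∘ ρ σ) (wordApply N.M w' ∘ ρ σ') := by
  ext i j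
  rw [crossGram_apply, Function.comp_apply, Function.comp_apply, ← (N.ι t).inner_map_map]
  exact integral_mul_eq_inner (h.zproc_ae_eq hpr t σ w i) (h.zproc_ae_eq hpr t σ' w' j)

theorem tracks_noise : N.Tracks v N.ν := N.ι_noise

theorem ι_matAct_ae_eq {a b : ℕ} (A : Matrix (Fin a) (Fin b) ℝ) {ξ : Fin b → N.space}
    {x : Ω → Fin b → ℝ} {t : ℤ} (hx : ∀ j, (N.ι t (ξ j) : Ω → ℝ) =ᵐ[μ] fun ω => x ω j)
    (i : Fin a) : (N.ι t (matAct A ξ i) : Ω → ℝ) =ᵐ[μ] fun ω => (A *ᵥ x ω) i := by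
  have := coeFn_sum_smul Finset.univ (A i) hx
  simp only [matAct, map_sum, map_smul]
  exact this

theorem Tracks.output {a b : ℕ} {x : ℤ → Ω → Fin a → ℝ} {e : ℤ → Ω → Fin b → ℝ}
    {ξ : Fin a → N.space} {ε : S → Fin b → N.space} (hε : N.Tracks e ε)
    (hx : ∀ t j, (N.ι t (ξ j) : Ω → ℝ) =ᵐ[μ] fun ω => x t ω j)
    (C : Matrix (Fin k) (Fin a) ℝ) (D : Matrix (Fin k) (Fin b) ℝ) {y : ℤ → Ω → Fin k → ℝ}
    (hy : ∀ t, ∀ᵐ ω ∂μ, y t ω = C *ᵥ x t ω + D *ᵥ e t ω) :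
    N.Tracks y fun σ => matAct C (N.M σ ∘ ξ) + matAct D (ε σ) := by
  intro t σ j
  have h1 : ∀ i, (N.ι (t + 1) ((N.M σ ∘ ξ) i) : Ω → ℝ) =ᵐ[μ]
      fun ω => ((u σ t ω / √(pr σ)) • x t ω) i := fun i => by
    filter_upwards [N.ι_map t σ (ξ i), hx t i] with ω h1 h2
    rw [Function.comp_apply, h1, h2]; rfl
  have h2 : ∀ i, (N.ι (t + 1) (ε σ i) : Ω → ℝ) =ᵐ[μ]
      fun ω => ((u σ t ω / √(pr σ)) • e t ω) i := hε t σ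
  simp only [Pi.add_apply, map_add]
  filter_upwards [hy t, ι_matAct_ae_eq C h1 j, ι_matAct_ae_eq D h2 j,
    Lp.coeFn_add (N.ι (t + 1) (matAct C (N.M σ ∘ ξ) j)) (N.ι (t + 1) (matAct D (ε σ) j))]
    with ω h3 h4 h5 h6
  rw [h6, Pi.add_apply, h4, h5, h3, Matrix.mulVec_smul, Matrix.mulVec_smul]
  simp only [Pi.smul_apply, Pi.add_apply, smul_eq_mul]
  ring

theorem Tracks.step [Fintype S] (hpr : ∀ σ, 0 < pr σ) {a b : ℕ} {x : ℤ → Ω → Fin a → ℝ}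
    {e : ℤ → Ω → Fin b → ℝ} {ξ : Fin a → N.space} {ε : S → Fin b → N.space} (hε : N.Tracks e ε)
    (t : ℤ) (hx : ∀ j, (N.ι t (ξ j) : Ω → ℝ) =ᵐ[μ] fun ω => x t ω j)
    (A : S → Matrix (Fin k) (Fin a) ℝ) (K : S → Matrix (Fin k) (Fin b) ℝ) (i : Fin k) :
    (N.ι (t + 1) ((∑ σ, √(pr σ) • (matAct (A σ) (N.M σ ∘ ξ) + matAct (K σ) (ε σ))) i) : Ω → ℝ)
      =ᵐ[μ] fun ω => (∑ σ, u σ t ω • (A σ *ᵥ x t ω + K σ *ᵥ e t ω)) i := by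
  have h1 : ∀ σ i, (N.ι (t + 1) ((N.M σ ∘ ξ) i) : Ω → ℝ) =ᵐ[μ]
      fun ω => ((u σ t ω / √(pr σ)) • x t ω) i := fun σ i => by
    filter_upwards [N.ι_map t σ (ξ i), hx i] with ω h1 h2
    rw [Function.comp_apply, h1, h2]; rfl
  have h2 : ∀ σ i, (N.ι (t + 1) (ε σ i) : Ω → ℝ) =ᵐ[μ]
      fun ω => ((u σ t ω / √(pr σ)) • e t ω) i := hε t
  have h3 : ∀ σ, (N.ι (t + 1) ((matAct (A σ) (N.M σ ∘ ξ) + matAct (K σ) (ε σ)) i) : Ω → ℝ)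
      =ᵐ[μ] fun ω => u σ t ω / √(pr σ) * (A σ *ᵥ x t ω + K σ *ᵥ e t ω) i := fun σ => by
    simp only [Pi.add_apply, map_add]
    filter_upwards [ι_matAct_ae_eq (A σ) (h1 σ) i, ι_matAct_ae_eq (K σ) (h2 σ) i,
      Lp.coeFn_add (N.ι (t + 1) (matAct (A σ) (N.M σ ∘ ξ) i))
        (N.ι (t + 1) (matAct (K σ) (ε σ) i))] with ω h4 h5 h6
    rw [h6, Pi.add_apply, h4, h5, Matrix.mulVec_smul, Matrix.mulVec_smul]
    simp only [Pi.smul_apply, smul_eq_mul]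
    ring
  have h4 := coeFn_sum_smul Finset.univ (fun σ => √(pr σ)) h3
  simp only [Finset.sum_apply, Pi.smul_apply, map_sum, map_smul]
  filter_upwards [h4] with ω h5
  rw [h5]
  exact Finset.sum_congr rfl fun σ _ => sqrt_mul_div_sqrt_mul hpr σ _ _

end NoiseModel

end Tracking

/-! ## Regular systems -/

section Regular

variable {Ω S : Type*} [MeasurableSpace Ω] [Fintype S] {μ : Measure Ω}
  {u : S → ℤ → Ω → ℝ} {pr : S → ℝ} {L : Set (List S)} {p : ℕ}

namespace NoiseModel

omit [Fintype S] in
theorem generatedHilbertSpace_le_range {m : ℕ} {v : ℤ → Ω → Fin m → ℝ} (hpr : ∀ σ, 0 < pr σ)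
    (N : NoiseModel μ u pr L v) (t : ℤ) :
    generatedHilbertSpace μ {g | ∃ (w : List S) (j : Fin m), w ≠ [] ∧
      g = fun ω => zproc u pr v w t ω j} ≤ LinearMap.range (N.ι t).toLinearMap := by
  have := N.complete
  refine Submodule.topologicalClosure_minimal _ (Submodule.span_le.2 ?_)
    (N.ι t).isometry.isClosedEmbedding.isClosed_range
  rintro f ⟨_, ⟨w, j, hw, rfl⟩, hf⟩
  obtain ⟨σ, w, rfl⟩ := List.exists_cons_of_ne_nil hw
  refine ⟨wordApply N.M w (N.ν σ j), ?_⟩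
  exact Lp.ext ((tracks_noise.zproc_ae_eq hpr t σ w j).trans hf.symm)

end NoiseModel

namespace GBS

variable {B : GBS μ u p}

theorem IsRegular.crossGram_transitions (hB : B.IsRegular pr L) (hpr : ∀ σ, 0 < pr σ)
    (N : NoiseModel μ u pr L B.v) (σ τ : S) (h : [σ, τ] ∉ L) :
    B.A τ * B.A σ = 0 ∧ B.A τ * B.K σ * crossGram (N.ν σ) (N.ν σ) = 0 := by
  refine ⟨(hB.transitions σ τ h).1, ?_⟩
  have := (hB.transitions σ τ h).2 0
  rwa [NoiseModel.tracks_noise.Tcov_eq (N := N) hpr] at this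

/-- Stationarity of the state. The covariances of the state with `M_w ν_σ` are computed by recursion
on `w`, each letter consuming one time step, so they do not depend on time; these vectors span a
dense subspace. -/
theorem IsRegular.exists_state (hB : B.IsRegular pr L) (hpr : ∀ σ, 0 < pr σ)
    (N : NoiseModel μ u pr L B.v) :
    ∃ ξ : Fin B.n → N.space, IsState N.M N.ν pr B.A B.K ξ ∧
      ∀ t i, (N.ι t (ξ i) : Ω → ℝ) =ᵐ[μ] fun ω => B.x t ω i := by
  have h1 : ∀ t i, ∃ f : N.space, (N.ι t f : Ω → ℝ) =ᵐ[μ] fun ω => B.x t ω i := fun t i => by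
    obtain ⟨F, hF, hFx⟩ := hB.state_mem t i
    obtain ⟨f, rfl⟩ := N.generatedHilbertSpace_le_range hpr t hF
    exact ⟨f, hFx⟩
  choose ξ hξ using h1
  have hstep : ∀ t, ξ (t + 1)
      = ∑ σ, √(pr σ) • (matAct (B.A σ) (N.M σ ∘ ξ t) + matAct (B.K σ) (N.ν σ)) := fun t => by
    funext i
    refine (N.ι (t + 1)).injective (Lp.ext ?_)
    refine (hξ (t + 1) i).trans (Filter.EventuallyEq.symm ?_)
    filter_upwards [NoiseModel.tracks_noise.step hpr t (hξ t) B.A B.K i, B.state_eq t]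
      with ω h1 h2
    rw [h1, h2]
  have hgen : ∀ σ w s t, crossGram (ξ s) (wordApply N.M w ∘ N.ν σ)
      = crossGram (ξ t) (wordApply N.M w ∘ N.ν σ) := by
    intro σ w
    suffices h : ∃ G, ∀ t, crossGram (ξ t) (wordApply N.M w ∘ N.ν σ) = G by
      obtain ⟨G, hG⟩ := h
      intro s t; rw [hG, hG]
    induction w using List.reverseRecOn with
    | nil =>
      refine ⟨√(pr σ) • (B.K σ * crossGram (N.ν σ) (N.ν σ)), fun t => ?_⟩
      obtain ⟨t, rfl⟩ : ∃ s, t = s + 1 := ⟨t - 1, by ring⟩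
      have := N.shift.crossGram_step (hstep t) (f := N.ν σ) fun j => noise_mem_block σ j
      rw [N.shift.crossGram_map_noise, Matrix.mul_zero, zero_add] at this
      exact this
    | append_singleton w τ ih =>
      obtain ⟨G, hG⟩ := ih
      have hcomp : wordApply N.M (w ++ [τ]) ∘ N.ν σ = N.M τ ∘ (wordApply N.M w ∘ N.ν σ) := by
        funext j; exact wordApply_append_singleton _ _ _
      have hb := fun j => wordApply_mem_block (noise_mem_block (M := N.M) (ν := N.ν) σ j) w
      rw [hcomp]
      by_cases hL : [(σ :: w).getLast (by simp), τ] ∈ L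
      · refine ⟨√(pr τ) • (B.A τ * G), fun t => ?_⟩
        obtain ⟨t, rfl⟩ : ∃ s, t = s + 1 := ⟨t - 1, by ring⟩
        rw [N.shift.crossGram_step (hstep t) (f := N.M τ ∘ (wordApply N.M w ∘ N.ν σ))
          fun j => map_mem_block τ _, N.shift.crossGram_noise_map, Matrix.mul_zero, add_zero,
          ← hG t]
        congr 2
        ext i j
        rw [crossGram_apply, crossGram_apply, real_inner_comm, Function.comp_apply,
          Function.comp_apply]
        exact (N.shift.inner_map_block hL (hb j) _).trans (real_inner_comm _ _)
      · refine ⟨0, fun t => ?_⟩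
        ext i j
        rw [crossGram_apply, Function.comp_apply]
        simp only [Function.comp_apply]
        rw [N.shift.map_block hL (hb j), inner_zero_right, Matrix.zero_apply]
  have hconst : ∀ s t, ξ s = ξ t := fun s t => by
    funext i
    have h2 : ∀ g ∈ cyc N.M N.ν, inner ℝ (ξ s i - ξ t i) g = 0 := fun g hg => by
      refine inner_eq_zero_of_mem_cyc (ContinuousLinearMap.id ℝ N.space) (fun σ w j => ?_) hg
      rw [inner_sub_left, sub_eq_zero]
      exact congrFun (congrFun (hgen σ w s t) i) j
    rw [N.dense] at h2
    exact sub_eq_zero.1 (inner_self_eq_zero.1 (h2 _ trivial))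
  refine ⟨ξ 0, ?_, fun t i => ?_⟩
  · have := hstep 0
    rwa [hconst (0 + 1) 0] at this
  · rw [hconst 0 t]; exact hξ t i

theorem Q_eq (hpr : ∀ σ, 0 < pr σ) (N : NoiseModel μ u pr L B.v) (σ : S) :
    B.Q σ = pr σ • crossGram (N.ν σ) (N.ν σ) := by
  ext i j
  rw [Matrix.smul_apply, crossGram_apply, ← (N.ι (0 + 1)).inner_map_map,
    ← integral_mul_eq_inner (N.ι_noise 0 σ i) (N.ι_noise 0 σ j), smul_eq_mul,
    ← integral_const_mul, Q, Matrix.of_apply]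
  congr 1
  funext ω
  have h := Real.mul_self_sqrt (hpr σ).le
  have h' := (Real.sqrt_pos.2 (hpr σ)).ne'
  nth_rewrite 1 [← h]
  field_simp

theorem IsRegular.existsUnique_lyapunov (hB : B.IsRegular pr L) :
    ∃! P, B.IsLyapunovSolution pr L P :=
  GBSRealization.existsUnique_lyapunov hB.stable (fun τ σ h => (hB.transitions τ σ h).1) _

/-- By uniqueness the solution of (1) is `p_σ ⟨M_σ ξ, M_σ ξ⟩`, so `B_σ` is the covariance of the
state with the shifted output. -/
theorem IsRegular.inputMatrix_eq (hB : B.IsRegular pr L) (hpr : ∀ σ, 0 < pr σ)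
    {N : NoiseModel μ u pr L B.v} {ξ : Fin B.n → N.space}
    (hξ : IsState N.M N.ν pr B.A B.K ξ) (σ : S) :
    B.inputMatrix pr L σ
      = crossGram ξ (matAct B.C (N.M σ ∘ ξ) + matAct B.D (N.ν σ)) := by
  have h1 : B.IsLyapunovSolution pr L fun σ => pr σ • crossGram (N.M σ ∘ ξ) (N.M σ ∘ ξ) :=
    fun σ => by
      beta_reduce
      conv_lhs => rw [N.shift.crossGram_map_state hpr hξ σ]
      simp only [Q_eq hpr N]
  have h2 : B.IsLyapunovSolution pr L (B.P pr L) := Classical.epsilon_spec ⟨_, h1⟩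
  have h3 : B.P pr L = _ := hB.existsUnique_lyapunov.unique h2 h1
  rw [N.shift.crossGram_state_output hξ, inputMatrix, h3, Q_eq hpr N]
  simp only [Matrix.mul_smul, Matrix.smul_mul, ← smul_add, smul_smul]
  congr 1
  rw [one_div, inv_mul_eq_div, Real.div_sqrt]

/-- `Λ^y_{σw}` equals `C ⟨ξ, M_w η_σ⟩`, because `v(t)` is orthogonal to the past, and each letter of
`w` acts on this covariance as `√p A`. -/
theorem IsRegular.represents (hB : B.IsRegular pr L) (hpr : ∀ σ, 0 < pr σ)
    (N : NoiseModel μ u pr L B.v) {y : ℤ → Ω → Fin p → ℝ} (hy : B.Realizes y) (t : ℤ) :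
    (B.representation pr L).Represents (outputSeries μ u pr y t) := by
  obtain ⟨ξ, hξ, hx⟩ := hB.exists_state hpr N
  set η : S → Fin p → N.space := fun σ => matAct B.C (N.M σ ∘ ξ) + matAct B.D (N.ν σ) with hη
  have hηy : N.Tracks y η := NoiseModel.tracks_noise.output hx B.C B.D hy
  have hηb : ∀ σ j, η σ j ∈ block N.M N.ν σ := fun σ j => matAct_add_matAct_mem_block _ _ _ _ _
  -- The current noise need not lie in the past at time `t`, so it is handled in `L²` directly
  -- rather than through `ι t`.
  let V : Fin B.m → Lp ℝ 2 μ := fun l => (hB.noise_rc.memLp t l).toLp _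
  have hV : ∀ l, (V l : Ω → ℝ) =ᵐ[μ] fun ω => B.v t ω l := fun l => MemLp.coeFn_toLp _
  have hΛ : ∀ σ w, Lcov μ u pr y (σ :: w) t = B.C * crossGram ξ (wordApply N.M w ∘ η σ) := by
    intro σ w
    ext i j
    have h1 : ((N.ι t (matAct B.C ξ i) + ∑ l, B.D i l • V l : Lp ℝ 2 μ) : Ω → ℝ)
        =ᵐ[μ] fun ω => y t ω i := by
      filter_upwards [Lp.coeFn_add (N.ι t (matAct B.C ξ i)) (∑ l, B.D i l • V l),
        NoiseModel.ι_matAct_ae_eq B.C (hx t) i, coeFn_sum_smul Finset.univ (B.D i) hV, hy t]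
        with ω h2 h3 h4 h5
      rw [h2, Pi.add_apply, h3, h4, h5]; rfl
    have h2 := integral_mul_eq_inner h1 (hηy.zproc_ae_eq hpr t σ w j)
    have h3 : ∀ l, inner ℝ (V l) (N.ι t (wordApply N.M w (η σ j))) = 0 := fun l => by
      rw [← integral_mul_eq_inner (hV l) (Filter.EventuallyEq.refl _ _)]
      exact N.integral_noise_mul t l _
    rw [inner_add_left, sum_inner, (N.ι t).inner_map_map] at h2
    simp only [real_inner_smul_left, h3, mul_zero, Finset.sum_const_zero, add_zero] at h2
    rw [← crossGram_matAct_left]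
    exact h2
  intro ⟨j, σ⟩ w
  funext i
  have h1 : outputSeries μ u pr y t (j, σ) w i
      = (B.C * (wordProd (fun σ => √(pr σ) • B.A σ) w * B.inputMatrix pr L σ)) i j := by
    rw [hB.inputMatrix_eq hpr hξ, ← N.shift.crossGram_state_wordApply hξ
      (hB.crossGram_transitions hpr N) (hηb σ) w, ← hΛ]
    rfl
  rw [h1]
  rfl

end GBS

end Regular

/-! ## Matrices of inclusions and quotients -/

theorem exists_inclusion_matrices {n : ℕ} (W : Submodule ℝ (Fin n → ℝ)) :
    ∃ (U : Matrix (Fin (Module.finrank ℝ W)) (Fin n) ℝ)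
      (T : Matrix (Fin n) (Fin (Module.finrank ℝ W)) ℝ), U * T = 1 ∧ (∀ c, T *ᵥ c ∈ W) ∧
      ∀ x ∈ W, T *ᵥ (U *ᵥ x) = x := by
  obtain ⟨P, hP⟩ := W.subtype.exists_leftInverse_of_injective W.ker_subtype
  let e := (Module.finBasis ℝ W).equivFun
  refine ⟨LinearMap.toMatrix' (e.toLinearMap ∘ₗ P),
    LinearMap.toMatrix' (W.subtype ∘ₗ e.symm.toLinearMap), ?_, fun c => ?_, fun x hx => ?_⟩
  · rw [← LinearMap.toMatrix'_comp, ← LinearMap.toMatrix'_id]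
    congr 1
    refine LinearMap.ext fun c => ?_
    have := LinearMap.congr_fun hP (e.symm c)
    simp only [LinearMap.comp_apply, LinearMap.id_apply, LinearEquiv.coe_coe] at this ⊢
    rw [this, LinearEquiv.apply_symm_apply]
  · rw [LinearMap.toMatrix'_mulVec]; exact (e.symm c).2
  · rw [LinearMap.toMatrix'_mulVec, LinearMap.toMatrix'_mulVec]
    have := LinearMap.congr_fun hP ⟨x, hx⟩
    simp only [LinearMap.comp_apply, LinearMap.id_apply, LinearEquiv.coe_coe,
      Submodule.subtype_apply, LinearEquiv.symm_apply_apply] at this ⊢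
    rw [this]

theorem exists_quotient_matrices {n : ℕ} (W : Submodule ℝ (Fin n → ℝ)) :
    ∃ (U : Matrix (Fin (Module.finrank ℝ ((Fin n → ℝ) ⧸ W))) (Fin n) ℝ)
      (T : Matrix (Fin n) (Fin (Module.finrank ℝ ((Fin n → ℝ) ⧸ W))) ℝ), U * T = 1 ∧
      (∀ x ∈ W, U *ᵥ x = 0) ∧ ∀ x, T *ᵥ (U *ᵥ x) - x ∈ W := by
  obtain ⟨P, hP⟩ := W.mkQ.exists_rightInverse_of_surjective W.range_mkQ
  let e := (Module.finBasis ℝ ((Fin n → ℝ) ⧸ W)).equivFun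
  refine ⟨LinearMap.toMatrix' (e.toLinearMap ∘ₗ W.mkQ),
    LinearMap.toMatrix' (P ∘ₗ e.symm.toLinearMap), ?_, fun x hx => ?_, fun x => ?_⟩
  · rw [← LinearMap.toMatrix'_comp, ← LinearMap.toMatrix'_id]
    congr 1
    refine LinearMap.ext fun c => ?_
    have := LinearMap.congr_fun hP (e.symm c)
    simp only [LinearMap.comp_apply, LinearMap.id_apply, LinearEquiv.coe_coe] at this ⊢
    rw [this, LinearEquiv.apply_symm_apply]
  · rw [LinearMap.toMatrix'_mulVec, LinearMap.comp_apply, Submodule.mkQ_apply,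
      (Submodule.Quotient.mk_eq_zero W).2 hx, map_zero]
  · rw [LinearMap.toMatrix'_mulVec, LinearMap.toMatrix'_mulVec,
      ← Submodule.Quotient.mk_eq_zero W, ← Submodule.mkQ_apply, map_sub, sub_eq_zero]
    have := LinearMap.congr_fun hP (W.mkQ x)
    simp only [LinearMap.comp_apply, LinearMap.id_apply, LinearEquiv.coe_coe,
      LinearEquiv.symm_apply_apply] at this ⊢
    rw [this]

namespace GBS

variable {Ω S : Type*} [MeasurableSpace Ω] [Fintype S] {μ : Measure Ω}
  {u : S → ℤ → Ω → ℝ} {pr : S → ℝ} {L : Set (List S)} {p : ℕ} {B : GBS μ u p}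
  {y : ℤ → Ω → Fin p → ℝ}

/-! ## Reduction of regular systems -/

/-- The first alternative restricts to an invariant subspace that almost surely contains the state,
the second divides by an invariant subspace contained in `ker C`. The noise is kept. -/
theorem IsRegular.exists_reduction (hB : B.IsRegular pr L) (hpr : ∀ σ, 0 < pr σ)
    (N : NoiseModel μ u pr L B.v) (hy : B.Realizes y) {r : ℕ}
    (U : Matrix (Fin r) (Fin B.n) ℝ) (T : Matrix (Fin B.n) (Fin r) ℝ) (hUT : U * T = 1)
    (h : ((∀ σ, T * (U * B.A σ * T) = B.A σ * T) ∧
        ∀ t, ∀ᵐ ω ∂μ, T *ᵥ (U *ᵥ B.x t ω) = B.x t ω) ∨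
      ((∀ σ, U * B.A σ * T * U = U * B.A σ) ∧ B.C * T * U = B.C)) :
    ∃ B' : GBS μ u p, B'.IsRegular pr L ∧ B'.Realizes y ∧ B'.n = r := by
  have hA : ∀ t, ∀ᵐ ω ∂μ, ∀ σ, (U * B.A σ * T) *ᵥ (U *ᵥ B.x t ω) = U *ᵥ (B.A σ *ᵥ B.x t ω) := by
    intro t
    rcases h with ⟨-, h⟩ | ⟨h, -⟩
    · filter_upwards [h t] with ω h σ
      rw [← Matrix.mulVec_mulVec, h, Matrix.mulVec_mulVec]
    · filter_upwards with ω σ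
      rw [Matrix.mulVec_mulVec, h, Matrix.mulVec_mulVec]
  have hC : ∀ t, ∀ᵐ ω ∂μ, (B.C * T) *ᵥ (U *ᵥ B.x t ω) = B.C *ᵥ B.x t ω := by
    intro t
    rcases h with ⟨-, h⟩ | ⟨-, h⟩
    · filter_upwards [h t] with ω h
      rw [← Matrix.mulVec_mulVec, h]
    · filter_upwards with ω
      rw [Matrix.mulVec_mulVec, h]
  let B' : GBS μ u p :=
    { n := r
      m := B.m
      A := fun σ => U * B.A σ * T
      K := fun σ => U * B.K σ
      C := B.C * T
      D := B.D
      x := fun t ω => U *ᵥ B.x t ω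
      v := B.v
      aemeasurable_x := fun t =>
        (Matrix.mulVecLin U).continuous_of_finiteDimensional.measurable.comp_aemeasurable
          (B.aemeasurable_x t)
      aemeasurable_v := B.aemeasurable_v
      state_eq := fun t => by
        filter_upwards [B.state_eq t, hA t] with ω h1 h2
        rw [h1, Matrix.mulVec_sum]
        refine Finset.sum_congr rfl fun σ _ => ?_
        rw [h2, Matrix.mulVec_smul, Matrix.mulVec_add, Matrix.mulVec_mulVec _ _ (B.K σ)] }
  refine ⟨B', ⟨hB.noise_rc, hB.noise_orth, fun t i => ?_, ?_, fun σ τ hL => ⟨?_, fun t => ?_⟩⟩,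
    fun t => ?_, rfl⟩
  · choose F hF hFx using hB.state_mem t
    refine ⟨∑ j, U i j • F j, Submodule.sum_mem _ fun j _ => Submodule.smul_mem _ _ (hF j), ?_⟩
    exact coeFn_sum_smul Finset.univ (U i) hFx
  · refine hB.stable.reduce U T hUT ?_
    rcases h with ⟨h, -⟩ | ⟨h, -⟩
    · exact Or.inl h
    · exact Or.inr h
  · have h0 := (hB.transitions σ τ hL).1
    show U * B.A τ * T * (U * B.A σ * T) = 0
    rcases h with ⟨h, -⟩ | ⟨h, -⟩
    · rw [Matrix.mul_assoc, h, Matrix.mul_assoc, ← Matrix.mul_assoc (B.A τ), h0]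
      simp
    · rw [← Matrix.mul_assoc, ← Matrix.mul_assoc, h, Matrix.mul_assoc U, h0]
      simp
  · have h0 := (hB.transitions σ τ hL).2 t
    show U * B.A τ * T * (U * B.K σ) * Tcov μ u pr B.v [σ] [σ] t = 0
    rcases h with ⟨-, h⟩ | ⟨h, -⟩
    -- `K` itself need not map into the range of `T`, but `K_σ ⟨ν_σ, ν_σ⟩` does: up to `√p_σ` it is
    -- the covariance of the state with `ν_σ`, and `T U` fixes the state.
    · obtain ⟨ξ, hξ, hx⟩ := hB.exists_state hpr N
      have hTU : matAct (T * U) ξ = ξ := by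
        funext i
        refine (N.ι 0).injective (Lp.ext ?_)
        filter_upwards [NoiseModel.ι_matAct_ae_eq (T * U) (hx 0) i, hx 0 i, h 0] with ω h1 h2 h3
        rw [h1, h2, ← Matrix.mulVec_mulVec, h3]
      have h1 := N.shift.crossGram_state hξ (f := N.ν σ) fun j => noise_mem_block σ j
      rw [N.shift.crossGram_map_noise, Matrix.mul_zero, zero_add] at h1
      have h2 : T * U * crossGram ξ (N.ν σ) = crossGram ξ (N.ν σ) := by
        rw [← crossGram_matAct_left, hTU]
      rw [h1, Matrix.mul_smul] at h2
      have h3 := smul_right_injective _ (Real.sqrt_pos.2 (hpr σ)).ne' h2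
      have h4 : Tcov μ u pr B.v [σ] [σ] t = crossGram (N.ν σ) (N.ν σ) :=
        NoiseModel.tracks_noise.Tcov_eq (N := N) hpr t σ σ [] []
      rw [h4] at h0 ⊢
      calc U * B.A τ * T * (U * B.K σ) * crossGram (N.ν σ) (N.ν σ)
          = U * B.A τ * (T * U * (B.K σ * crossGram (N.ν σ) (N.ν σ))) := by
            simp only [Matrix.mul_assoc]
        _ = U * (B.A τ * B.K σ * crossGram (N.ν σ) (N.ν σ)) := by
            rw [h3]; simp only [Matrix.mul_assoc]
        _ = 0 := by rw [h0, Matrix.mul_zero]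
    · rw [← Matrix.mul_assoc, h, Matrix.mul_assoc, Matrix.mul_assoc,
        ← Matrix.mul_assoc (B.A τ), h0, Matrix.mul_zero]
  · filter_upwards [hy t, hC t] with ω h1 h2
    rw [h1, ← h2]

/-! ## The innovation form of a regular system -/

/-- Here `T U` is only required to fix the reachable vectors `A_w B_{σ,j}`, not the state. This
suffices after passing to the innovation form, whose state lies in their span. -/
theorem IsRegular.exists_innovation_reduction [IsProbabilityMeasure μ]
    (hu : InputAssumption μ u) (hB : B.IsRegular pr L)
    (hpr : ∀ σ, 0 < pr σ) (hL : IsAdmissible μ u L) (hy : B.Realizes y) {r : ℕ}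
    (U : Matrix (Fin r) (Fin B.n) ℝ) (T : Matrix (Fin B.n) (Fin r) ℝ) (hUT : U * T = 1)
    (hA : ∀ σ, T * (U * B.A σ * T) = B.A σ * T)
    (hR : ∀ σ w, T * U * (wordProd (fun σ => √(pr σ) • B.A σ) w * B.inputMatrix pr L σ)
      = wordProd (fun σ => √(pr σ) • B.A σ) w * B.inputMatrix pr L σ) :
    ∃ B' : GBS μ u p, B'.IsRegular pr L ∧ B'.Realizes y ∧ B'.n = r := by
  obtain ⟨N⟩ := nonempty_noiseModel hu hpr hL hB.noise_rc hB.noise_orth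
  obtain ⟨ξ, hξ, hx⟩ := hB.exists_state hpr N
  have := N.complete
  obtain ⟨ξ', K', ε, hε, hξ', hmem, horth, hwhite, hreach, htrans⟩ :=
    N.shift.exists_innovation hpr hB.stable hξ (hB.crossGram_transitions hpr N) B.C B.D
  have hTU : matAct (T * U) ξ' = ξ' := by
    funext i
    -- Row `i` of `T U - 1` annihilates the reachable vectors, hence the filter state.
    have h1 := hreach (fun j => (T * U) i j - (1 : Matrix (Fin B.n) (Fin B.n) ℝ) i j) fun σ w => by
      have h2 := N.shift.crossGram_state_wordApply hξ (hB.crossGram_transitions hpr N)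
        (f := matAct B.C (N.M σ ∘ ξ) + matAct B.D (N.ν σ))
        (fun j => matAct_add_matAct_mem_block _ _ _ _ _) w
      rw [← hB.inputMatrix_eq hpr hξ] at h2
      funext j
      have h3 := congrFun (congrFun (hR σ w) i) j
      rw [← h2, Matrix.mul_apply] at h3
      simp only [Matrix.vecMul, dotProduct, sub_mul, Finset.sum_sub_distrib, h3]
      simp [Matrix.one_apply]
    simp only [sub_smul, Finset.sum_sub_distrib, sub_eq_zero, Matrix.one_apply, ite_smul, one_smul,
      zero_smul, Finset.sum_ite_eq, Finset.mem_univ, if_true] at h1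
    exact h1
  let x' : ℤ → Ω → Fin B.n → ℝ := fun t ω i => N.ι t (ξ' i) ω
  have hx' : ∀ t i, (N.ι t (ξ' i) : Ω → ℝ) =ᵐ[μ] fun ω => x' t ω i := fun t i =>
    Filter.EventuallyEq.refl _ _
  -- The innovation process `y - C x'`, written through the estimation error of the state.
  let e : ℤ → Ω → Fin p → ℝ := fun t ω => B.C *ᵥ (B.x t ω - x' t ω) + B.D *ᵥ B.v t ω
  have hd : ∀ t i, (N.ι t ((ξ - ξ') i) : Ω → ℝ) =ᵐ[μ] fun ω => (B.x t ω - x' t ω) i :=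
    fun t i => by
      simp only [Pi.sub_apply, map_sub]
      filter_upwards [hx t i, hx' t i, Lp.coeFn_sub (N.ι t (ξ i)) (N.ι t (ξ' i))] with ω h1 h2 h3
      rw [h3, Pi.sub_apply, h1, h2]
  have hεe : N.Tracks e ε := by
    have := NoiseModel.tracks_noise.output (x := fun t ω => B.x t ω - x' t ω) hd B.C B.D
      (y := e) fun t => Filter.Eventually.of_forall fun ω => rfl
    rwa [← funext hε] at this
  have hεb : ∀ σ j, ε σ j ∈ block N.M N.ν σ := fun σ j => by
    rw [hε]; exact matAct_add_matAct_mem_block _ _ _ _ _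
  let V : ℤ → Fin B.m → Lp ℝ 2 μ := fun t l => (hB.noise_rc.memLp t l).toLp _
  have hV : ∀ t l, (V t l : Ω → ℝ) =ᵐ[μ] fun ω => B.v t ω l := fun t l => MemLp.coeFn_toLp _
  let F : ℤ → Fin p → Lp ℝ 2 μ :=
    fun t i => N.ι t (matAct B.C (ξ - ξ') i) + ∑ l, B.D i l • V t l
  have hF : ∀ t i, (F t i : Ω → ℝ) =ᵐ[μ] fun ω => e t ω i := fun t i => by
    filter_upwards [Lp.coeFn_add (N.ι t (matAct B.C (ξ - ξ') i)) (∑ l, B.D i l • V t l),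
      NoiseModel.ι_matAct_ae_eq B.C (hd t) i, coeFn_sum_smul Finset.univ (B.D i) (hV t)]
      with ω h2 h3 h4
    rw [h2, Pi.add_apply, h3, h4]; rfl
  have hz := hεe.zproc_ae_eq hpr
  have hT := hεe.Tcov_eq hpr
  have hz_ne : ∀ {w : List S}, w ≠ [] → ∃ σ w', w = σ :: w' := List.exists_cons_of_ne_nil
  have hLe : ∀ w : List S, w ≠ [] → ∀ t, Lcov μ u pr e w t = 0 := by
    intro w hw t
    obtain ⟨σ, w, rfl⟩ := hz_ne hw
    ext i j
    have h1 := integral_mul_eq_inner (hF t i) (hz t σ w j)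
    have h2 : ∀ l, inner ℝ (V t l) (N.ι t (wordApply N.M w (ε σ j))) = 0 := fun l => by
      rw [← integral_mul_eq_inner (hV t l) (Filter.EventuallyEq.refl _ _)]
      exact N.integral_noise_mul t l _
    have h3 : inner ℝ (matAct B.C (ξ - ξ') i) (wordApply N.M w (ε σ j)) = 0 := by
      simp only [matAct, sum_inner, real_inner_smul_left, horth σ w _ j]
      simp
    rw [inner_add_left, sum_inner, (N.ι t).inner_map_map, h3] at h1
    simp only [real_inner_smul_left, h2, mul_zero, Finset.sum_const_zero, add_zero] at h1
    exact h1
  have hTne : ∀ w v : List S, w ≠ [] → v ≠ [] → w ≠ v → ∀ t, Tcov μ u pr e w v t = 0 := by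
    intro w v hw hv hwv t
    obtain ⟨σ, w, rfl⟩ := hz_ne hw
    obtain ⟨σ', v, rfl⟩ := hz_ne hv
    rw [hT]
    ext i j
    exact N.shift.inner_wordApply_of_ne hεb hwhite hwv i j
  have hne : ∀ {w v : List S} {σ : S}, w ++ [σ] ∈ L → v ++ [σ] ∉ L → w ≠ v := by
    rintro w v σ h1 h2 rfl; exact h2 h1
  have hrc : IsRC μ u pr L e :=
    { memLp := fun t i => (memLp_congr_ae (hF t i)).1 (Lp.memLp _)
      memLp_z := fun w hw t i => by
        obtain ⟨σ, w, rfl⟩ := hz_ne hw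
        exact (memLp_congr_ae (hz t σ w i)).1 (Lp.memLp _)
      mean := fun t i => by
        have hv : ∀ l, Integrable (fun ω => B.v t ω l) μ := fun l =>
          (hB.noise_rc.memLp t l).integrable one_le_two
        have h1 : (fun ω => e t ω i) =ᵐ[μ]
            fun ω => N.ι t (matAct B.C (ξ - ξ') i) ω + ∑ l, B.D i l * B.v t ω l := by
          filter_upwards [NoiseModel.ι_matAct_ae_eq B.C (hd t) i] with ω h3
          rw [h3]; rfl
        rw [integral_congr_ae h1, integral_add ((Lp.memLp _).integrable one_le_two)
          (integrable_finsetSum _ fun l _ => (hv l).const_mul _), N.integral_ι,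
          integral_finsetSum _ fun l _ => (hv l).const_mul _]
        simp [integral_const_mul, hB.noise_rc.mean]
      mean_z := fun w hw t i => by
        obtain ⟨σ, w, rfl⟩ := hz_ne hw
        rw [← integral_congr_ae (hz t σ w i), N.integral_ι]
      stat_L := fun w hw t k => by rw [hLe w hw, hLe w hw]
      stat_T := fun w v hw hv t k => by
        obtain ⟨σ, w, rfl⟩ := hz_ne hw
        obtain ⟨σ', v, rfl⟩ := hz_ne hv
        rw [hT, hT]
      letters := fun σ σ' h => hTne _ _ (by simp) (by simp) (by simpa using h)
      -- Distinct words give zero on both sides; for equal words the identity is the isometry of `M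
      -- σ` on the block of the last letter.
      shift_same := fun w v hw hv σ h t => by
        by_cases hwv : w = v
        · subst hwv
          rw [or_self] at h
          obtain ⟨ρ, w, rfl⟩ := hz_ne hw
          have hlast : [(ρ :: w).getLast (by simp), σ] ∈ L := by
            by_contra h'
            refine hL.append_pair_notMem h' (ρ :: w).dropLast ?_
            rwa [List.dropLast_append_getLast]
          rw [List.cons_append, hT, hT]
          ext i j
          rw [crossGram_apply, crossGram_apply, Function.comp_apply, Function.comp_apply,
            wordApply_append_singleton, wordApply_append_singleton,
            N.shift.inner_map_block hlast (wordApply_mem_block (hεb ρ i) w)]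
          rfl
        · rw [hTne w v hw hv hwv, hTne _ _ (by simp) (by simp) (by simpa using hwv)]
      shift_ne := fun w v _ _ σ σ' h => hTne _ _ (by simp) (by simp) fun h' => h <| by
        simpa using (List.append_inj' h' rfl).2
      letter_same := fun w hw σ _ t => by
        rw [hLe w hw, Matrix.transpose_zero]
        exact hTne _ _ (by simp) (by simp) (by simpa using hw) t
      letter_ne := fun w hw σ σ' _ => hTne _ _ (by simp) (by simp) fun h' => hw <| by
        simpa using congrArg List.length h'
      vanish := fun w v hw hv h t => by
        by_cases hwv : w = v
        · subst hwv
          rw [or_self] at h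
          ext i j
          rw [Tcov, crossCov, Matrix.of_apply, Matrix.zero_apply, integral_eq_zero_of_ae]
          filter_upwards [zproc_ae_zero (pr := pr) (hL.vanish w hw h (t - 1)) e] with ω hω
          simp [hω]
        · exact hTne w v hw hv hwv t
      vanish_left := fun w v hw hv σ h1 h2 => hTne v w hv hw (hne h1 h2).symm
      vanish_right := fun w v hw hv σ h1 h2 => hTne v w hv hw (hne h1 h2) }
  let Bi : GBS μ u p :=
    { n := B.n
      m := p
      A := B.A
      K := K'
      C := B.C
      D := 1
      x := x'
      v := e
      aemeasurable_x := fun t => aemeasurable_pi_lambda _ fun i =>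
        (Lp.aestronglyMeasurable _).aemeasurable
      aemeasurable_v := fun t => aemeasurable_pi_lambda _ fun i =>
        ((Lp.aestronglyMeasurable (F t i)).congr (hF t i)).aemeasurable
      state_eq := fun t => by
        have h1 : ∀ i, ∀ᵐ ω ∂μ, x' (t + 1) ω i
            = (∑ σ, u σ t ω • (B.A σ *ᵥ x' t ω + K' σ *ᵥ e t ω)) i := fun i => by
          have h2 := hεe.step hpr t (hx' t) B.A K' i
          have h3 : _ = ξ' := hξ'.symm
          rw [h3] at h2
          exact h2
        filter_upwards [ae_all_iff.2 h1] with ω hω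
        exact funext hω }
  have hBi : Bi.IsRegular pr L := by
    refine ⟨hrc, hTne, fun t i => ⟨N.ι t (ξ' i), ?_, hx' t i⟩, hB.stable,
      fun σ τ h => ⟨(hB.transitions σ τ h).1, fun t => ?_⟩⟩
    · have h1 : cyc N.M ε ≤ (generatedHilbertSpace μ {g | ∃ (w : List S) (j : Fin p), w ≠ [] ∧
          g = fun ω => zproc u pr e w t ω j}).comap (N.ι t).toLinearMap := by
        refine cyc_le ((Submodule.isClosed_topologicalClosure _).preimage (N.ι t).continuous)
          fun σ w j => ?_
        exact Submodule.le_topologicalClosure _ (Submodule.subset_span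
          ⟨_, ⟨σ :: w, j, by simp, rfl⟩, hz t σ w j⟩)
      exact h1 (hmem i)
    · have h1 : Tcov μ u pr e [σ] [σ] t = crossGram (ε σ) (ε σ) := hT t σ σ [] []
      show B.A τ * K' σ * Tcov μ u pr e [σ] [σ] t = 0
      rw [h1]; exact htrans σ τ h
  have hBiy : Bi.Realizes y := fun t => by
    filter_upwards [hy t] with ω hω
    show y t ω = B.C *ᵥ x' t ω + (1 : Matrix (Fin p) (Fin p) ℝ) *ᵥ e t ω
    rw [hω, Matrix.one_mulVec]
    simp only [e, Matrix.mulVec_sub]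
    abel
  -- The reduction needs a model built from the noise of the system being reduced, which is now the
  -- innovation process.
  obtain ⟨N'⟩ := nonempty_noiseModel hu hpr hL hBi.noise_rc hBi.noise_orth
  refine hBi.exists_reduction hpr N' hBiy U T hUT (Or.inl ⟨hA, fun t => ?_⟩)
  have h1 : ∀ i, ∀ᵐ ω ∂μ, ((T * U) *ᵥ x' t ω) i = x' t ω i := fun i => by
    filter_upwards [NoiseModel.ι_matAct_ae_eq (T * U) (hx' t) i, hx' t i] with ω h1 h2
    rw [hTU] at h1
    rw [← h1, ← h2]
  filter_upwards [ae_all_iff.2 h1] with ω hω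
  show T *ᵥ (U *ᵥ x' t ω) = x' t ω
  rw [Matrix.mulVec_mulVec]
  exact funext hω

/-! ## Minimal systems -/

/-- Otherwise the span of the vectors `A_w B_{σ,j}` is a proper invariant subspace, and restricting
the innovation form to it contradicts minimality. -/
theorem IsMinimal.isReachable [IsProbabilityMeasure μ] (hu : InputAssumption μ u)
    (hpr : ∀ σ, 0 < pr σ) (hL : IsAdmissible μ u L) (hB : B.IsMinimal pr L y) :
    (B.representation pr L).IsReachable := by
  obtain ⟨hB, hy, hmin⟩ := hB
  intro (l : Fin B.n → ℝ) hl
  by_contra hl0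
  let A' : S → Matrix (Fin B.n) (Fin B.n) ℝ := fun σ => √(pr σ) • B.A σ
  let b : Fin p × S → Fin B.n → ℝ := fun j i => B.inputMatrix pr L j.2 i j.1
  let W : Submodule ℝ (Fin B.n → ℝ) :=
    Submodule.span ℝ (Set.range fun i : (Fin p × S) × List S => wordProd A' i.2 *ᵥ b i.1)
  have hW : ∀ j w, wordProd A' w *ᵥ b j ∈ W := fun j w => Submodule.subset_span ⟨(j, w), rfl⟩
  have hWA : ∀ σ, ∀ x ∈ W, B.A σ *ᵥ x ∈ W := by
    intro σ
    have h1 : W ≤ W.comap (Matrix.mulVecLin (A' σ)) := by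
      refine Submodule.span_le.2 ?_
      rintro _ ⟨⟨j, w⟩, rfl⟩
      have := hW j (w ++ [σ])
      rw [wordProd_append_singleton, ← Matrix.mulVec_mulVec] at this
      exact this
    intro x hx
    have h2 : (√(pr σ) • B.A σ) *ᵥ x ∈ W := h1 hx
    rw [Matrix.smul_mulVec] at h2
    exact (W.smul_mem_iff (Real.sqrt_pos.2 (hpr σ)).ne').1 h2
  obtain ⟨U, T, hUT, hTW, hTU⟩ := exists_inclusion_matrices W
  obtain ⟨B', hB', hy', hn⟩ := hB.exists_innovation_reduction hu hpr hL hy U T hUT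
    (fun σ => Matrix.ext_of_mulVec_single fun i => by
      rw [← Matrix.mulVec_mulVec, ← Matrix.mulVec_mulVec, ← Matrix.mulVec_mulVec,
        ← Matrix.mulVec_mulVec]
      exact hTU _ (hWA σ _ (hTW _)))
    (fun σ w => by
      ext i j
      have h1 := congrFun (hTU _ (hW (j, σ) w)) i
      rw [Matrix.mulVec_mulVec] at h1
      exact h1)
  have h1 := hmin B' hB' hy'
  have h2 : Module.finrank ℝ W < B.n := by
    have : W ≠ ⊤ := by
      intro h
      -- A nonzero `l` orthogonal to all of `W` cannot lie in `W`, since then `l ⬝ᵥ l = 0`.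
      have h3 : W ≤ LinearMap.ker (dotProductBilin ℝ ℝ l) := by
        refine Submodule.span_le.2 ?_
        rintro _ ⟨⟨j, w⟩, rfl⟩
        exact hl j w
      rw [h] at h3
      have h4 : l ⬝ᵥ l = 0 := h3 (Submodule.mem_top : l ∈ ⊤)
      exact hl0 (dotProduct_self_eq_zero.1 h4)
    simpa using Submodule.finrank_lt this
  omega

/-- Otherwise the states with zero response form a nonzero invariant subspace of `ker C`, and
dividing by it lowers the dimension without changing the output or the noise. -/
theorem IsMinimal.isObservable [IsProbabilityMeasure μ] (hu : InputAssumption μ u)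
    (hpr : ∀ σ, 0 < pr σ) (hL : IsAdmissible μ u L) (hB : B.IsMinimal pr L y) :
    (B.representation pr L).IsObservable := by
  obtain ⟨hB, hy, hmin⟩ := hB
  intro (x₀ : Fin B.n → ℝ) hx₀
  by_contra hx0
  let A' : S → Matrix (Fin B.n) (Fin B.n) ℝ := fun σ => √(pr σ) • B.A σ
  let W : Submodule ℝ (Fin B.n → ℝ) :=
    ⨅ w, LinearMap.ker (Matrix.mulVecLin (B.C * wordProd A' w))
  have hmem : ∀ x, x ∈ W ↔ ∀ w, (B.C * wordProd A' w) *ᵥ x = 0 := fun x => by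
    simp [W, Submodule.mem_iInf]
  have hWA : ∀ σ, ∀ x ∈ W, B.A σ *ᵥ x ∈ W := by
    intro σ x hx
    rw [hmem] at hx ⊢
    intro w
    have h1 := hx (σ :: w)
    have h2 : B.C * wordProd A' (σ :: w) = √(pr σ) • (B.C * wordProd A' w * B.A σ) := by
      simp [wordProd, A', Matrix.mul_assoc]
    rw [h2, Matrix.smul_mulVec, smul_eq_zero, ← Matrix.mulVec_mulVec] at h1
    exact h1.resolve_left (Real.sqrt_pos.2 (hpr σ)).ne'
  have hWC : ∀ x ∈ W, B.C *ᵥ x = 0 := fun x hx => by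
    simpa [wordProd] using (hmem x).1 hx []
  obtain ⟨U, T, hUT, hUW, hTU⟩ := exists_quotient_matrices W
  obtain ⟨N⟩ := nonempty_noiseModel hu hpr hL hB.noise_rc hB.noise_orth
  obtain ⟨B', hB', hy', hn⟩ := hB.exists_reduction hpr N hy U T hUT (Or.inr
    ⟨fun σ => Matrix.ext_of_mulVec_single fun i => by
        rw [← Matrix.mulVec_mulVec, ← Matrix.mulVec_mulVec, ← Matrix.mulVec_mulVec,
          ← Matrix.mulVec_mulVec, ← sub_eq_zero, ← Matrix.mulVec_sub, ← Matrix.mulVec_sub]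
        exact hUW _ (hWA σ _ (hTU _)),
      Matrix.ext_of_mulVec_single fun i => by
        rw [← Matrix.mulVec_mulVec, ← Matrix.mulVec_mulVec, ← sub_eq_zero, ← Matrix.mulVec_sub]
        exact hWC _ (hTU _)⟩)
  have h1 := hmin B' hB' hy'
  have h2 : 0 < Module.finrank ℝ W := by
    rw [Module.finrank_pos_iff, Submodule.nontrivial_iff_ne_bot, Submodule.ne_bot_iff]
    refine ⟨x₀, (hmem _).2 fun w => ?_, hx0⟩
    rw [← Matrix.mulVec_mulVec]
    exact hx₀ w
  have h3 := Submodule.finrank_quotient_add_finrank W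
  rw [Module.finrank_fin_fun] at h3
  omega

end GBS

end GBSRealization

/-! ### The minimality theorem -/

theorem mainTheorem5 {Ω S : Type*} [MeasurableSpace Ω] (μ : Measure Ω) [IsProbabilityMeasure μ]
    [Fintype S] (u : S → ℤ → Ω → ℝ) (hu : GBSRealization.InputAssumption μ u)
    (pr : S → ℝ) (hpr : ∀ σ, 0 < pr σ)
    (L : Set (List S)) (hL : GBSRealization.IsAdmissible μ u L)
    {p : ℕ} (y : ℤ → Ω → Fin p → ℝ) :
    (∀ B : GBSRealization.GBS μ u p, B.IsRegular pr L → B.Realizes y →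
      (∃! P, B.IsLyapunovSolution pr L P) ∧
      ∀ t : ℤ, B.IsMinimal pr L y ↔
        (B.representation pr L).IsMinimalOf (GBSRealization.outputSeries μ u pr y t)) ∧
    (∀ B₁ B₂ : GBSRealization.GBS μ u p, B₁.IsMinimal pr L y → B₂.IsMinimal pr L y →
      (B₁.representation pr L).Isomorphic (B₂.representation pr L)) := by
  have hrep : ∀ B : GBSRealization.GBS μ u p, B.IsRegular pr L → B.Realizes y → ∀ t,
      (B.representation pr L).Represents (GBSRealization.outputSeries μ u pr y t) := by
    intro B hB hy t
    obtain ⟨N⟩ := GBSRealization.nonempty_noiseModel hu hpr hL hB.noise_rc hB.noise_orth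
    exact hB.represents hpr N hy t
  refine ⟨fun B hB hy => ⟨hB.existsUnique_lyapunov, fun t => ⟨fun h => ?_, fun h => ?_⟩⟩,
    fun B₁ B₂ h₁ h₂ => ?_⟩
  · exact GBSRealization.Representation.isMinimalOf (hrep B hB hy t) (h.isReachable hu hpr hL)
      (h.isObservable hu hpr hL)
  -- Every competing system yields a representation of the same family with its own dimension.
  · exact ⟨hB, hy, fun B' hB' hy' => h.2 _ (hrep B' hB' hy' t)⟩
  · exact GBSRealization.Representation.isomorphic_of_reachable_of_observable
      (hrep B₁ h₁.1 h₁.2.1 0) (h₁.isReachable hu hpr hL) (h₁.isObservable hu hpr hL)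
      (hrep B₂ h₂.1 h₂.2.1 0) (h₂.isReachable hu hpr hL) (h₂.isObservable hu hpr hL)
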